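/- **Setting.** A rooted dipole is a 2-cell embedding of a loopless graph with exactly two vertices in an oriented closed surface, with a distinguished root vertex and root edge, up to orientation-preserving isomorphism; a bi-rooted dipole has in addition a second distinguished edge, the secondary edge. At the root vertex, Region 1 is the region swept out counterclockwise from the root edge to the secondary edge, and Region 2 is its complement; at the non-root vertex, Region 3 is the region swept out counterclockwise from the root edge to the secondary edge, and Region 4 is its complement. An edge other than these two is an $a$-, $b$-, $c$- or $d$-edge if its ends lie in Regions 2 and 3, 1 and 3, 2 and 4, or 1 and 4, respectively; $\alpha(D),\beta(D),\gamma(D),\delta(D)$ are the numbers of such edges of $D$, and $g(D)$ is the genus. Mark the corners at the root vertex in Region 1 by $\bullet$ and those in Region 2 by $\circ$. The root face is the face containing the first corner counterclockwise from the root edge at the root vertex (the root corner). Let $R(D)$ be the string of marks read in a counterclockwise boundary walk of the root face from the root corner, and $\Lambda(D)$ the multiset of cyclic strings $(S)$ read in counterclockwise boundary walks of the non-root faces. With indeterminates $g_S$ (indexed by strings) and $f_{(S)}$ (indexed by cyclic strings), and $f_{\Lambda(D)}=\prod_{(S)\in\Lambda(D)}f_{(S)}$, put $$B=\sum_{D:\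 \gamma(D)=\delta(D)=0}\frac{x^{\alpha(D)+1}}{(\alpha(D)+1)!}\,\frac{y^{\beta(D)}}{\beta(D)!}\,u^{2g(D)}\,g_{R(D)}f_{\Lambda(D)},\qquad B^{(1)}=[u^2]B ,$$ the sum being over all bi-rooted dipoles without $c$- and $d$-edges. Let $$C'=\sum_{R}\Big(\sum_{2\le i\le \ell(R)} g_{R_1\cdots R_i}\,f_{(R_1R_{i+1}\cdots R_{\ell(R)})}\Big)\frac{\partial}{\partial g_R},\qquad \phi_k(y)=\sum_{n\ge k}h_{n-k}(\underbrace{f_{(\bullet)},\dots,f_{(\bullet)}}_{k})\frac{y^n}{n!}\quad(\phi_0=1),$$ where $h_j$ is the complete symmetric function of degree $j$, and let $\tau_{R,k}$ be the solution of $\left(\frac{\partial}{\partial y}-C'\right)\tau_{R,k}=g_{\bullet R}\,\phi_k(y)$ with $\tau_{R,k}|_{y=0}=0$. For $\lambda\vdash n$ let $\psi_\lambda$ be the number of rooted dipoles with $n$ edges and face-degree sequence $2\lambda$. **Lemma.** The series $\tau_{\bullet\circ,0}$ exists and is unique, and the generating series for $(a,b,0,0)$-dipoles on the torus is $$B^{(1)}=\tau_{\bullet\circ,0}\;x\exp\!\big(x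 f_{(\circ)}\big)+g_\bullet\left(\sum_{n\ge3}\frac{x^n}{n!}\,\psi_{(3,1^{n-3})}\,f_{(\circ\circ\circ)}\,f_{(\circ)}^{\,n-3}+\sum_{n\ge4}\frac{x^n}{n!}\,\psi_{(2^2,1^{n-4})}\,f_{(\circ\circ)}^{\,2}\,f_{(\circ)}^{\,n-4}\right).$$ Moreover, for $\lambda=(3,1^{n-3})$, $n\ge3$, and $\lambda=(2^2,1^{n-4})$, $n\ge4$, $$\psi_\lambda=\frac1n\,|\mathcal C_\lambda|\sum_{0\le k\le n-1}\binom{n-1}{k}^{-1}[y^k]\,(1+y)^{-1}\prod_{i}\big(1-(-y)^{\lambda_i}\big),$$ where $\mathcal C_\lambda$ is the set of permutations in $\mathfrak S_n$ of cycle type $\lambda$. -/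

import Mathlib

noncomputable section

open scoped Classical

namespace DipoleSeries

/-! ### Rooted dipoles and bi-rooted dipoles -/

/-- A rooted loopless dipole with `n` edges, as a rotation system.  The edges are labelled by
`Fin n` in counterclockwise order around the root vertex, starting with the root edge, so that the
root edge is `0` and the rotation at the root vertex is `finRotate n`.  Every isomorphism class of
rooted dipoles has exactly one such labelling, and it is then determined by the counterclockwise
rotation at the non-root vertex, which may be any full cycle. -/
structure Dipole (n : ℕ) where
  pos : 0 < n
  rot : Equiv.Perm (Fin n)
  fullCycle : rot.IsCycleOn Set.univ

/-- A rooted dipole with a second distinguished edge, the secondary edge. -/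
structure BiDipole (n : ℕ) extends Dipole n where
  sec : Fin n
  sec_ne : sec ≠ ⟨0, pos⟩

instance (n : ℕ) : Fintype (Dipole n) :=
  Fintype.ofInjective (fun D : Dipole n => D.rot) (by
    rintro ⟨_, _, _⟩ ⟨_, _, _⟩ h
    cases h
    rfl)

instance (n : ℕ) : Fintype (BiDipole n) :=
  Fintype.ofInjective (fun D : BiDipole n => (D.rot, D.sec)) (by
    rintro ⟨⟨_, _, _⟩, _, _⟩ ⟨⟨_, _, _⟩, _, _⟩ h
    cases h
    rfl)

namespace Dipole

variable {n : ℕ} (D : Dipole n)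

/-- The root edge. -/
def root : Fin n := ⟨0, D.pos⟩

/-- The corner `i` at the root vertex is the one between the edge `i` and its counterclockwise
successor.  A counterclockwise boundary walk of a face (the face lying to the left) leaves
the corner `i` along the edge `i`, leaves the non-root vertex along the edge `rot⁻¹ i`, and
arrives at the corner that precedes this edge at the root vertex. -/
def faceStep : Equiv.Perm (Fin n) := (finRotate n)⁻¹ * D.rot⁻¹

/-- The face containing the corner `c` of the root vertex, given as the cyclic sequence of its
corners at the root vertex in a counterclockwise boundary walk. -/
def faceOf (c : Fin n) : Cycle (Fin n) := Function.periodicOrbit D.faceStep c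

/-- The set of all faces. -/
def faces : Finset (Cycle (Fin n)) := Finset.univ.image D.faceOf

/-- The root face, which contains the root corner: the first corner counterclockwise from the root
edge at the root vertex. -/
def rootFace : Cycle (Fin n) := D.faceOf D.root

/-- The half face-degree sequence: a face of degree `2k` has `k` corners at the root vertex. -/
def halfFaceDegrees : Multiset ℕ := D.faces.val.map Cycle.length

/-- Twice the genus: `2 g = 2 - (V - E + F)`, where `V = 2`. -/
def twoGenus : ℤ := 2 - (2 - (n : ℤ) + (D.faces.card : ℤ))

end Dipole

namespace BiDipole

variable {n : ℕ} (D : BiDipole n)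

/-- An ordinary edge: neither the root edge nor the secondary edge. -/
def IsOrdinary (e : Fin n) : Prop := e ≠ D.root ∧ e ≠ D.sec

/-- The edge `e` passes through Region 1, the region at the root vertex that is swept out
counterclockwise from the root edge to the secondary edge.  For ordinary edges, Region 2 is
the complement. -/
def InRegion1 (e : Fin n) : Prop := e < D.sec

/-- The edge `e` passes through Region 3, the region at the non-root vertex that is swept out
counterclockwise from the root edge to the secondary edge.  For ordinary edges, Region 4 is
the complement. -/
def InRegion3 (e : Fin n) : Prop :=
  ∃ k : ℕ, (D.rot ^ k) D.root = e ∧ ∀ j ≤ k, (D.rot ^ j) D.root ≠ D.sec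

/-- The number of `a`-edges (ordinary edges with ends in Regions 2 and 3). -/
def numA : ℕ :=
  (Finset.univ.filter fun e => D.IsOrdinary e ∧ ¬ D.InRegion1 e ∧ D.InRegion3 e).card

/-- The number of `b`-edges (ordinary edges with ends in Regions 1 and 3). -/
def numB : ℕ :=
  (Finset.univ.filter fun e => D.IsOrdinary e ∧ D.InRegion1 e ∧ D.InRegion3 e).card

/-- The number of `c`-edges (ordinary edges with ends in Regions 2 and 4). -/
def numC : ℕ :=
  (Finset.univ.filter fun e => D.IsOrdinary e ∧ ¬ D.InRegion1 e ∧ ¬ D.InRegion3 e).card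

/-- The number of `d`-edges (ordinary edges with ends in Regions 1 and 4). -/
def numD : ℕ :=
  (Finset.univ.filter fun e => D.IsOrdinary e ∧ D.InRegion1 e ∧ ¬ D.InRegion3 e).card

/-- The mark of the corner `i` at the root vertex: black (`true`) if it lies in Region 1, white
(`false`) if it lies in Region 2. -/
def mark (i : Fin n) : Bool := decide (i < D.sec)

/-- The binary string of the root face, read in a counterclockwise boundary walk that starts at the
root corner. -/
def rootString : List Bool :=
  (List.range (Function.minimalPeriod D.faceStep D.root)).map
    fun j => D.mark (D.faceStep^[j] D.root)

/-- The multiset of cyclic binary strings of the non-root faces. -/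
def nonRootStrings : Multiset (Cycle Bool) :=
  (D.faces.erase D.rootFace).val.map (Cycle.map D.mark)

end BiDipole

/-! ### The indeterminates and the rings of series -/

/-- The indeterminates `g_S`, indexed by binary strings, and `f_(S)`, indexed by cyclic binary
strings.  The symbol `true` is the black dot, `false` the white dot. -/
inductive Indet : Type
  | g : List Bool → Indet
  | f : Cycle Bool → Indet

/-- Polynomials with rational coefficients in the indeterminates `g_S` and `f_(S)`. -/
abbrev Poly : Type := MvPolynomial Indet ℚ

/-- Formal power series in `x` over `Poly`. -/
abbrev SeriesX : Type := PowerSeries Poly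

/-- Formal power series in `x` and `y` over `Poly` (the outer variable is `y`). -/
abbrev SeriesXY : Type := PowerSeries SeriesX

/-- Formal power series in `x`, `y` and `u` over `Poly` (the outermost variable is `u`). -/
abbrev SeriesXYU : Type := PowerSeries SeriesXY

/-- The indeterminate `g_S`. -/
def gVar (S : List Bool) : Poly := MvPolynomial.X (Indet.g S)

/-- The indeterminate `f_(S)`. -/
def fVar (S : List Bool) : Poly := MvPolynomial.X (Indet.f (S : Cycle Bool))

/-- The monomial `g_{R(D)} f_{Λ(D)}` that encodes the bi-rooted dipole `D`. -/
def encoding {n : ℕ} (D : BiDipole n) : Poly :=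
  gVar D.rootString * (D.nonRootStrings.map fun S => MvPolynomial.X (Indet.f S)).prod

/-! ### The generating series -/

/-- The `(a,b,0,0)`-dipole series `B`: the sum over all bi-rooted dipoles `D` without `c`- and
`d`-edges of `x^(α+1)/(α+1)! y^β/β! u^(2g) g_{R(D)} f_{Λ(D)}`, where `α` and `β` are the numbers of
`a`- and `b`-edges.  A dipole contributing to `x^i y^b` has `α + β + 2 = i + b + 1` edges. -/
def seriesB : SeriesXYU :=
  PowerSeries.mk fun k => PowerSeries.mk fun b => PowerSeries.mk fun i =>
    ∑ D : BiDipole (i + b + 1) with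
        D.numC = 0 ∧ D.numD = 0 ∧ D.numA + 1 = i ∧ D.numB = b ∧ D.twoGenus = (k : ℤ),
      (1 / ((i.factorial : ℚ) * (b.factorial : ℚ))) • encoding D

/-- The genus `g` part `B^(g) = [u^(2g)] B`. -/
def seriesBGenus (g : ℕ) : SeriesXY := PowerSeries.coeff (2 * g) seriesB

/-- The number `ψ_μ` of rooted dipoles with `n` edges and face-degree sequence `2μ`, `μ ⊢ n`. -/
def psi (n : ℕ) (μ : Multiset ℕ) : ℕ :=
  (Finset.univ.filter fun D : Dipole n => D.halfFaceDegrees = μ).card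

/-- The explicit expression
`(1/n) |C_μ| ∑_{0 ≤ k ≤ n-1} binom(n-1,k)⁻¹ [y^k] (1+y)⁻¹ ∏ᵢ (1 - (-y)^(μᵢ))`, where `C_μ` is the
conjugacy class of the permutations of `n` symbols with cycle type `μ`. -/
def psiFormula (n : ℕ) (μ : Multiset ℕ) : ℚ :=
  (1 / (n : ℚ)) *
    ((Finset.univ.filter fun p : Equiv.Perm (Fin n) => p.partition.parts = μ).card : ℚ) *
    ∑ k ∈ Finset.range n, ((n - 1).choose k : ℚ)⁻¹ *
      PowerSeries.coeff k
        ((1 + PowerSeries.X : PowerSeries ℚ)⁻¹ *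
          (μ.map fun j => 1 - (-PowerSeries.X : PowerSeries ℚ) ^ j).prod)

/-! ### The cut operator and the functions `φ` and `τ` -/

/-- The operator
`C' = ∑_R (∑_{2 ≤ i ≤ ℓ(R)} g_{R_1⋯R_i} f_{(R_1 R_{i+1}⋯R_{ℓ(R)})}) ∂/∂g_R` on polynomials. -/
def cutPoly : Derivation ℚ Poly Poly :=
  MvPolynomial.mkDerivation ℚ fun
    | Indet.g R => ∑ i ∈ Finset.Icc 2 R.length, gVar (R.take i) * fVar (R.take 1 ++ R.drop i)
    | Indet.f _ => 0

/-- The operator `C'` on series in `x` and `y`, acting on each coefficient. -/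
def cut (T : SeriesXY) : SeriesXY :=
  PowerSeries.mk fun b => PowerSeries.mk fun i =>
    cutPoly (PowerSeries.coeff i (PowerSeries.coeff b T))

/-- A polynomial in the `g_S` and `f_(S)`, as a series in `x` and `y`. -/
def constXY (P : Poly) : SeriesXY := PowerSeries.C (PowerSeries.C P)

/-- The series `φ_k(y) = ∑_{n ≥ k} h_{n-k}(f_(•), …, f_(•)) y^n / n!`, with `k` arguments of the
complete symmetric function `h_{n-k}`.  For `k = 0` this is `1`. -/
def phi (k : ℕ) : SeriesXY :=
  PowerSeries.mk fun n => PowerSeries.C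
    (if k ≤ n then
      (1 / (n.factorial : ℚ)) •
        MvPolynomial.aeval (fun _ : Fin k => fVar [true]) (MvPolynomial.hsymm (Fin k) ℚ (n - k))
    else 0)

/-- `T` is the series `τ_{R,k}`: the solution of `(∂/∂y - C') T = g_{•R} φ_k(y)` that vanishes at
`y = 0`. -/
def IsTau (R : List Bool) (k : ℕ) (T : SeriesXY) : Prop :=
  PowerSeries.derivative SeriesX T - cut T = constXY (gVar (true :: R)) * phi k ∧
    PowerSeries.constantCoeff T = 0

/-- The partition `(3, 1^{n-3})` of `n ≥ 3`. -/
def hook3 (n : ℕ) : Multiset ℕ := 3 ::ₘ Multiset.replicate (n - 3) 1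

/-- The partition `(2^2, 1^{n-4})` of `n ≥ 4`. -/
def doubleTwo (n : ℕ) : Multiset ℕ := 2 ::ₘ 2 ::ₘ Multiset.replicate (n - 4) 1

/-- The series `x exp(x f_(○))`. -/
def xExp : SeriesX :=
  PowerSeries.X * PowerSeries.rescale (fVar [false]) (PowerSeries.exp Poly)

/-- The series `∑_{n ≥ 3} x^n/n! ψ_{(3,1^{n-3})} f_(○○○) f_(○)^{n-3}`. -/
def hookSeries : SeriesX :=
  PowerSeries.mk fun n =>
    if 3 ≤ n then
      ((psi n (hook3 n) : ℚ) / (n.factorial : ℚ)) •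
        (fVar [false, false, false] * fVar [false] ^ (n - 3))
    else 0

/-- The series `∑_{n ≥ 4} x^n/n! ψ_{(2^2,1^{n-4})} f_(○○)^2 f_(○)^{n-4}`. -/
def doubleTwoSeries : SeriesX :=
  PowerSeries.mk fun n =>
    if 4 ≤ n then
      ((psi n (doubleTwo n) : ℚ) / (n.factorial : ℚ)) •
        (fVar [false, false] ^ 2 * fVar [false] ^ (n - 4))
    else 0

end DipoleSeries

end

noncomputable section

open scoped Classical

namespace DipoleSeries

open Equiv

/-! The faces of a dipole are the cycles of `faceStep` on the corners `0, …, n-1` of the root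
vertex, and a permutation `π` arises from a dipole, exactly one, if and only if `finRotate n * π` is
a full cycle. On the torus there are `n - 2` faces, so the lengths of the cycles exceed 1 by a total
of 2, and `π` is a 3-cycle or a product of two disjoint transpositions
(`Dipole.exists_faceStep_eq`). The full cycle condition then fixes the shape: the 3-cycle must run
through `p < q < r` in increasing order, and the transpositions must cross, as `(a c)(b d)` with `a
< b < c < d`. Hence the two values of `psi` are `n.choose 3` and `n.choose 4`; the reciprocal
binomial formula is evaluated separately and gives the same numbers.

There are no `c`- and `d`-edges exactly when the root edge follows the secondary edge at the
non-root vertex, which says that `π` sends the root corner `0` to the corner `b` just before the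
secondary edge `b + 1` (`BiDipole.rot_sec_eq_root_iff`). If `b = 0`, the root face is a digon and
the three or four moved corners are chosen freely among the other `n - 1`; this gives the term in
`g_•`. If `b > 0`, then `π` is `(0 b r)` with `b < r`, or `(0 b)(s t)` with `0 < s < b < t`. The
encodings are the same within each type, so the coefficient is a count times a monomial.

On the other side, `C'` maps the span of `g_{••○}` and `g_{••}` over the ring of the `f`-variables
to itself and is triangular there. Its iterates on `g_{••○}` are therefore explicit
(`cutPoly_tauPoly`), and they give the unique solution `tauSeries`. Comparing coefficients finishes
the proof (`seriesBGenus_one`). -/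

/-- The cyclic permutation `p ↦ q ↦ r ↦ p`. -/
def threeCycle {n : ℕ} (p q r : Fin n) : Perm (Fin n) := swap p q * swap q r

/-- The double transposition `(a c)(b d)`. -/
def doubleSwap {n : ℕ} (a b c d : Fin n) : Perm (Fin n) := swap a c * swap b d

/-! ### Pointwise values of the two kinds of permutations -/

section apply
variable {n : ℕ} {p q r a b c d x : Fin n}

lemma threeCycle_apply (hpq : p ≠ q) (hqr : q ≠ r) (hpr : p ≠ r) (x : Fin n) :
    threeCycle p q r x = if x = p then q else if x = q then r else if x = r then p else x := by
  simp only [threeCycle, Perm.mul_apply, swap_apply_def]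
  split_ifs <;> simp_all

lemma doubleSwap_apply (hab : a < b) (hbc : b < c) (hcd : c < d) (x : Fin n) :
    doubleSwap a b c d x =
      if x = a then c else if x = b then d else if x = c then a else if x = d then b else x := by
  have := hab.ne; have := hbc.ne; have := hcd.ne; have := (hab.trans hbc).ne
  have := (hbc.trans hcd).ne; have := (hab.trans (hbc.trans hcd)).ne
  simp only [doubleSwap, Perm.mul_apply, swap_apply_def]
  split_ifs <;> simp_all

end apply

/-! ### Criteria for `finRotate n * π` to be a full cycle -/

section rotation
variable {n : ℕ}

lemma finRotate_val_of_lt {x : Fin n} (h : x.val + 1 < n) :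
    (finRotate n x).val = x.val + 1 := by
  obtain _ | n := n
  · exact x.elim0
  · exact coe_finRotate_of_ne_last (by rintro rfl; simp at h)

lemma finRotate_eq_iff {x y : Fin n} (h : y.val = x.val + 1) : finRotate n x = y := by
  ext
  rw [finRotate_val_of_lt (by omega), h]

/-- On corners fixed by `π` the product is just the successor map, so its orbit walks through any
gap between moved corners. -/
lemma sameCycle_of_fixed (π : Perm (Fin n)) {x y : Fin n} (hxy : x ≤ y)
    (h : ∀ z, x ≤ z → z < y → π z = z) : (finRotate n * π).SameCycle x y := by
  obtain ⟨k, hk⟩ : ∃ k : ℕ, y.val = x.val + k := ⟨y.val - x.val, by omega⟩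
  induction k generalizing y with
  | zero =>
    have : x = y := Fin.ext (by omega)
    rw [this]
  | succ k ih =>
    have hlt : x.val + k < n := by omega
    set z : Fin n := ⟨x.val + k, hlt⟩ with hz
    have hzy : z < y := by rw [Fin.lt_def]; simp [hz]; omega
    have h1 := ih (y := z) (by rw [Fin.le_def]; simp [hz])
      (fun w hw hw' => h w hw (hw'.trans hzy)) rfl
    have h2 : (finRotate n * π) z = y := by
      rw [Perm.mul_apply, h z (by rw [Fin.le_def]; simp [hz]) hzy]
      exact finRotate_eq_iff (by simp [hz]; omega)
    rw [← h2]
    exact Perm.sameCycle_apply_right.mpr h1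

/-- Lying on a common cycle is an equivalence relation, so it suffices to link neighbours; no orbit
has to be listed in full, and the wrap from the last corner to the first is never needed. -/
lemma isCycleOn_of_sameCycle_succ (τ : Perm (Fin n))
    (h : ∀ x y : Fin n, y.val = x.val + 1 → τ.SameCycle x y) : τ.IsCycleOn Set.univ := by
  refine ⟨Set.bijOn_univ.mpr τ.bijective, ?_⟩
  have key : ∀ k : ℕ, ∀ x y : Fin n, y.val = x.val + k → τ.SameCycle x y := by
    intro k
    induction k with
    | zero => intro x y hxy; rw [Fin.ext (by omega : x.val = y.val)]
    | succ k ih =>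
      intro x y hxy
      exact (ih x ⟨x.val + k, by omega⟩ rfl).trans (h _ _ (by simp; omega))
  intro x _ y _
  rcases le_total x y with hxy | hxy
  · exact key (y.val - x.val) x y (by rw [Fin.le_def] at hxy; omega)
  · exact (key (x.val - y.val) y x (by rw [Fin.le_def] at hxy; omega)).symm

/-- The product jumps `p → q+1` and `r → p+1`; walking through the gaps gives the chain `p, q+1, r,
p+1, q` on one cycle. Each of `p`, `q`, `r` is thereby linked to its successor, where it has one,
and the other corners step there directly. -/
lemma isCycleOn_threeCycle {p q r : Fin n} (hpq : p < q) (hqr : q < r) :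
    (finRotate n * threeCycle p q r).IsCycleOn Set.univ := by
  have happ := threeCycle_apply hpq.ne hqr.ne (hpq.trans hqr).ne
  set τ := finRotate n * threeCycle p q r with hτ
  have hstep : ∀ x, τ.SameCycle x (τ x) := fun x => Perm.sameCycle_apply_right.mpr (Perm.SameCycle.refl _ _)
  have hp1 : p.val + 1 < n := by omega
  have hq1 : q.val + 1 < n := by omega
  have e1 : τ.SameCycle p ⟨q.val + 1, hq1⟩ := by
    have := hstep p
    rwa [show τ p = ⟨q.val + 1, hq1⟩ by
      rw [hτ, Perm.mul_apply, happ, if_pos rfl]; exact finRotate_eq_iff rfl] at this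
  have e2 : τ.SameCycle ⟨q.val + 1, hq1⟩ r := by
    refine sameCycle_of_fixed _ (by rw [Fin.le_def]; simp; omega) fun z h1 h2 => ?_
    rw [Fin.le_def] at h1
    simp only at h1
    rw [happ, if_neg (by omega), if_neg (by omega), if_neg (by omega)]
  have e3 : τ.SameCycle r ⟨p.val + 1, hp1⟩ := by
    have := hstep r
    rwa [show τ r = ⟨p.val + 1, hp1⟩ by
      rw [hτ, Perm.mul_apply, happ, if_neg (by omega), if_neg (by omega), if_pos rfl]
      exact finRotate_eq_iff rfl] at this
  have e4 : τ.SameCycle ⟨p.val + 1, hp1⟩ q := by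
    refine sameCycle_of_fixed _ (by rw [Fin.le_def]; simp; omega) fun z h1 h2 => ?_
    rw [Fin.le_def] at h1
    simp only at h1
    rw [happ, if_neg (by omega), if_neg (by omega), if_neg (by omega)]
  refine isCycleOn_of_sameCycle_succ τ fun x y hxy => ?_
  by_cases hxp : x = p
  · obtain rfl : y = ⟨p.val + 1, hp1⟩ := Fin.ext (by simp [hxy, hxp])
    rw [hxp]
    exact (e1.trans e2).trans e3
  by_cases hxq : x = q
  · obtain rfl : y = ⟨q.val + 1, hq1⟩ := Fin.ext (by simp [hxy, hxq])
    rw [hxq]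
    exact ((e2.trans e3).trans e4).symm
  by_cases hxr : x = r
  · have := hstep q
    rw [show τ q = y by
      rw [hτ, Perm.mul_apply, happ, if_neg hpq.ne', if_pos rfl]
      exact finRotate_eq_iff (by rw [hxy, hxr])] at this
    rw [hxr]
    exact (e3.trans e4).trans this
  · have := hstep x
    rwa [show τ x = y by
      rw [hτ, Perm.mul_apply, happ, if_neg hxp, if_neg hxq, if_neg hxr]
      exact finRotate_eq_iff hxy] at this

/-- The jumps `a → c+1`, `c → a+1`, `d → b+1` and the gaps between consecutive moved corners link
`a` with `d`, `d` with `c`, and `c` with `b`, which joins all four corners to their successors. -/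
lemma isCycleOn_doubleSwap {a b c d : Fin n} (hab : a < b) (hbc : b < c) (hcd : c < d) :
    (finRotate n * doubleSwap a b c d).IsCycleOn Set.univ := by
  have happ := doubleSwap_apply hab hbc hcd
  set τ := finRotate n * doubleSwap a b c d with hτ
  have hstep : ∀ x y z, doubleSwap a b c d x = y → z.val = y.val + 1 → τ.SameCycle x z := by
    intro x y z h1 h2
    rw [← show τ x = z by rw [hτ, Perm.mul_apply, h1]; exact finRotate_eq_iff h2]
    exact Perm.sameCycle_apply_right.mpr (Perm.SameCycle.refl _ _)
  have hint : ∀ x y : Fin n, x ≤ y → (∀ z, x ≤ z → z < y → z ≠ a ∧ z ≠ b ∧ z ≠ c ∧ z ≠ d) →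
      τ.SameCycle x y := by
    intro x y hxy h
    refine sameCycle_of_fixed _ hxy fun z h1 h2 => ?_
    obtain ⟨h3, h4, h5, h6⟩ := h z h1 h2
    rw [happ, if_neg h3, if_neg h4, if_neg h5, if_neg h6]
  have ha1 : a.val + 1 < n := by omega
  have hb1 : b.val + 1 < n := by omega
  have hc1 : c.val + 1 < n := by omega
  have ea : τ.SameCycle a ⟨c.val + 1, hc1⟩ := hstep a c _ (by simp [happ]) rfl
  have ec : τ.SameCycle c ⟨a.val + 1, ha1⟩ := hstep c a _ (by
    rw [happ, if_neg (by omega), if_neg (by omega), if_pos rfl]) rfl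
  have ed : τ.SameCycle d ⟨b.val + 1, hb1⟩ := hstep d b _ (by
    rw [happ, if_neg (by omega), if_neg (by omega), if_neg (by omega), if_pos rfl]) rfl
  have i1 : τ.SameCycle ⟨a.val + 1, ha1⟩ b := hint _ _ (by rw [Fin.le_def]; simp; omega)
    fun z h1 h2 => by rw [Fin.le_def] at h1; simp only at h1; omega
  have i2 : τ.SameCycle ⟨b.val + 1, hb1⟩ c := hint _ _ (by rw [Fin.le_def]; simp; omega)
    fun z h1 h2 => by rw [Fin.le_def] at h1; simp only at h1; omega
  have i3 : τ.SameCycle ⟨c.val + 1, hc1⟩ d := hint _ _ (by rw [Fin.le_def]; simp; omega)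
    fun z h1 h2 => by rw [Fin.le_def] at h1; simp only at h1; omega
  have ad := ea.trans i3
  have dc := ed.trans i2
  have cb := ec.trans i1
  refine isCycleOn_of_sameCycle_succ τ fun x y hxy => ?_
  by_cases hxa : x = a
  · obtain rfl : y = ⟨a.val + 1, ha1⟩ := Fin.ext (by simp [hxy, hxa])
    rw [hxa]
    exact (ad.trans dc).trans ec
  by_cases hxb : x = b
  · obtain rfl : y = ⟨b.val + 1, hb1⟩ := Fin.ext (by simp [hxy, hxb])
    rw [hxb]
    exact (i2.trans cb).symm
  by_cases hxc : x = c
  · obtain rfl : y = ⟨c.val + 1, hc1⟩ := Fin.ext (by simp [hxy, hxc])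
    rw [hxc]
    exact (i3.trans dc).symm
  by_cases hxd : x = d
  · rw [hxd]
    refine (dc.trans cb).trans (hstep b d y ?_ (by rw [hxy, hxd]))
    rw [happ, if_neg (by omega), if_pos rfl]
  · exact hstep x x y (by rw [happ, if_neg hxa, if_neg hxb, if_neg hxc, if_neg hxd]) hxy

/-- The half-open interval `(p, q]` is stable under the product and contains `q` but not `p`. The
strict bound `π x < q` also prevents `finRotate` from wrapping around. -/
lemma not_isCycleOn_of_mapsTo {π : Perm (Fin n)} {p q : Fin n} (hpq : p < q)
    (h : ∀ x, p < x → x ≤ q → p ≤ π x ∧ π x < q) :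
    ¬ (finRotate n * π).IsCycleOn Set.univ := by
  intro hc
  have hmaps : ∀ x, p < x ∧ x ≤ q → p < (finRotate n * π) x ∧ (finRotate n * π) x ≤ q := by
    intro x hx
    have h1 := h x hx.1 hx.2
    have h2 : (finRotate n (π x)).val = (π x).val + 1 := finRotate_val_of_lt (by omega)
    rw [Perm.mul_apply, Fin.lt_def, Fin.le_def, h2]
    omega
  have hiter : ∀ k : ℕ, p < ((finRotate n * π) ^ k) q ∧ ((finRotate n * π) ^ k) q ≤ q := by
    intro k
    induction k with
    | zero => exact ⟨hpq, le_rfl⟩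
    | succ k ih => rw [pow_succ', Perm.mul_apply]; exact hmaps _ ih
  obtain ⟨k, -, hk⟩ := (hc.2 (Set.mem_univ q) (Set.mem_univ p)).exists_pow_eq'
  have := (hiter k).1
  rw [hk] at this
  exact lt_irrefl _ this

end rotation

/-! ### Normal forms: increasing 3-cycles and crossing transpositions -/

section normalForm
variable {n : ℕ}

lemma threeCycle_rotate {p q r : Fin n} (hpq : p ≠ q) (hqr : q ≠ r) (hpr : p ≠ r) :
    threeCycle p q r = threeCycle q r p := by
  ext x
  rw [threeCycle_apply hpq hqr hpr, threeCycle_apply hqr hpr.symm hpq.symm]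
  split_ifs <;> simp_all

/-- Rotate the cycle so that `p` is least. In the wrong orientation `p < r < q`, the interval `(p,
r]` is stable under the product. -/
lemma exists_lt_threeCycle {p q r : Fin n} (hpq : p ≠ q) (hqr : q ≠ r) (hpr : p ≠ r)
    (h : (finRotate n * threeCycle p q r).IsCycleOn Set.univ) :
    ∃ p' q' r' : Fin n, p' < q' ∧ q' < r' ∧ threeCycle p q r = threeCycle p' q' r' := by
  wlog hmin : p < q ∧ p < r generalizing p q r
  · rw [threeCycle_rotate hpq hqr hpr] at h ⊢
    by_cases h4 : q < r ∧ q < p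
    · exact this hqr hpr.symm hpq.symm h h4
    · rw [threeCycle_rotate hqr hpr.symm hpq.symm] at h ⊢
      exact this hpr.symm hpq hqr.symm h ⟨by omega, by omega⟩
  rcases lt_or_gt_of_ne hqr with h2 | h2
  · exact ⟨p, q, r, hmin.1, h2, rfl⟩
  · refine absurd h (not_isCycleOn_of_mapsTo hmin.2 fun x h3 h4 => ?_)
    rw [threeCycle_apply hpq hqr hpr, if_neg h3.ne', if_neg (by omega)]
    split_ifs <;> omega

/-- By symmetry `a < c`, `b < d` and `a < b`. If the transpositions are side by side, `(a, c]` is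
stable; if they are nested, `(b, d]` is. Only the crossing position remains. Giving `π` by its
values keeps the symmetries free of commutation arguments. -/
lemma exists_lt_doubleSwap {a b c d : Fin n} {π : Perm (Fin n)} (hac : a ≠ c) (hbd : b ≠ d)
    (hab : a ≠ b) (had : a ≠ d) (hcb : c ≠ b) (hcd : c ≠ d)
    (ha : π a = c) (hb : π b = d) (hc : π c = a) (hd : π d = b)
    (hfix : ∀ x, x ≠ a → x ≠ b → x ≠ c → x ≠ d → π x = x)
    (h : (finRotate n * π).IsCycleOn Set.univ) :
    ∃ a' b' c' d' : Fin n, a' < b' ∧ b' < c' ∧ c' < d' ∧ π = doubleSwap a' b' c' d' := by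
  wlog h1 : a < c generalizing a b c d
  · exact this hac.symm hbd hcb hcd hab had hc hb ha hd (fun x _ _ _ _ => hfix x ‹_› ‹_› ‹_› ‹_›)
      (by omega)
  wlog h2 : b < d generalizing a b c d
  · exact this hac hbd.symm had hab hcd hcb ha hd hc hb (fun x _ _ _ _ => hfix x ‹_› ‹_› ‹_› ‹_›)
      h1 (by omega)
  wlog h3 : a < b generalizing a b c d
  · exact this hbd hac hab.symm hcb.symm had.symm hcd.symm hb ha hd hc
      (fun x _ _ _ _ => hfix x ‹_› ‹_› ‹_› ‹_›) h2 h1 (by omega)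
  have hval : ∀ x, π x = if x = a then c else if x = b then d else if x = c then a else
      if x = d then b else x := by
    intro x
    split_ifs with e1 e2 e3 e4
    · rw [e1, ha]
    · rw [e2, hb]
    · rw [e3, hc]
    · rw [e4, hd]
    · exact hfix x e1 e2 e3 e4
  rcases lt_or_gt_of_ne hcb with h4 | h4
  · refine absurd h (not_isCycleOn_of_mapsTo h1 fun x h5 h6 => ?_)
    rw [hval]
    split_ifs <;> omega
  rcases lt_or_gt_of_ne hcd with h5 | h5
  · refine ⟨a, b, c, d, h3, h4, h5, Equiv.ext fun x => ?_⟩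
    rw [hval, doubleSwap_apply h3 h4 h5]
  · refine absurd h (not_isCycleOn_of_mapsTo h2 fun x h5 h6 => ?_)
    rw [hval]
    split_ifs <;> omega

end normalForm

/-! ### Faces as cycles of `faceStep`, and the classification on the torus -/

namespace Dipole
variable {n : ℕ} (D : Dipole n)

lemma rot_eq : D.rot = (finRotate n * D.faceStep)⁻¹ := by
  simp [faceStep]

lemma faceStep_injective : Function.Injective (faceStep : Dipole n → Perm (Fin n)) := by
  intro D E h
  have : D.rot = E.rot := by rw [rot_eq, rot_eq, h]
  cases D; cases E; cases this; rfl

lemma isCycleOn_faceStep : (finRotate n * D.faceStep).IsCycleOn Set.univ := by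
  have := D.fullCycle
  rw [rot_eq] at this
  exact Perm.isCycleOn_inv.mp this

/-- The dipole whose faces are the cycles of a given permutation. -/
def ofFaceStep (π : Perm (Fin n)) (hn : 0 < n)
    (h : (finRotate n * π).IsCycleOn Set.univ) : Dipole n :=
  ⟨hn, (finRotate n * π)⁻¹, Perm.isCycleOn_inv.mpr h⟩

@[simp]
lemma faceStep_ofFaceStep (π : Perm (Fin n)) (hn : 0 < n)
    (h : (finRotate n * π).IsCycleOn Set.univ) : (ofFaceStep π hn h).faceStep = π := by
  simp [faceStep, ofFaceStep]

lemma mem_periodicPts (x : Fin n) : x ∈ Function.periodicPts D.faceStep :=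
  D.faceStep.injective.mem_periodicPts x

lemma mem_faceOf {x y : Fin n} : x ∈ D.faceOf y ↔ ∃ k, D.faceStep^[k] y = x :=
  Function.mem_periodicOrbit_iff (D.mem_periodicPts y)

lemma faceOf_eq_iff {x y : Fin n} : D.faceOf x = D.faceOf y ↔ x ∈ D.faceOf y := by
  constructor
  · intro h
    rw [← h]
    exact Function.self_mem_periodicOrbit (D.mem_periodicPts x)
  · intro h
    obtain ⟨k, rfl⟩ := D.mem_faceOf.mp h
    exact Function.periodicOrbit_apply_iterate_eq (D.mem_periodicPts y) k

lemma length_faceOf (x : Fin n) : (D.faceOf x).length = Function.minimalPeriod D.faceStep x :=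
  Function.periodicOrbit_length

lemma length_faceOf_pos (x : Fin n) : 0 < (D.faceOf x).length := by
  rw [length_faceOf]
  exact Function.minimalPeriod_pos_of_mem_periodicPts (D.mem_periodicPts x)

lemma mem_faces {F : Cycle (Fin n)} : F ∈ D.faces ↔ ∃ x, D.faceOf x = F := by
  simp [faces]

lemma card_fiber_faceOf {F : Cycle (Fin n)} (hF : F ∈ D.faces) :
    (Finset.univ.filter fun x => D.faceOf x = F).card = F.length := by
  obtain ⟨y, rfl⟩ := D.mem_faces.mp hF
  have h1 : (Finset.univ.filter fun x => D.faceOf x = D.faceOf y) = (D.faceOf y).toFinset := by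
    ext x
    simp only [Finset.mem_filter, Finset.mem_univ, true_and, faceOf_eq_iff, Cycle.toFinset,
      Multiset.mem_toFinset]
    induction D.faceOf y using Quotient.inductionOn' with
    | h l => rfl
  have h2 : (D.faceOf y).Nodup := Function.nodup_periodicOrbit
  rw [h1]
  revert h2
  induction D.faceOf y using Quotient.inductionOn' with
  | h l => exact fun h2 => List.toFinset_card_of_nodup h2

lemma sum_length_faces : ∑ F ∈ D.faces, F.length = n := by
  have h := Finset.card_eq_sum_card_fiberwise (f := D.faceOf) (s := Finset.univ) (t := D.faces)
    (fun x _ => by simpa using D.mem_faces.mpr ⟨x, rfl⟩)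
  rw [Finset.card_univ, Fintype.card_fin] at h
  rw [← Finset.sum_congr rfl fun F hF => D.card_fiber_faceOf hF]
  exact h.symm

/-- Every face has positive length, so the truncated subtraction is exact, and the total excess of
the face lengths over 1 is `n` minus the number of faces. -/
lemma sum_length_sub_one : ∑ F ∈ D.faces, (F.length - 1) + D.faces.card = n := by
  conv_rhs => rw [← D.sum_length_faces]
  rw [Finset.card_eq_sum_ones, ← Finset.sum_add_distrib]
  refine Finset.sum_congr rfl fun F hF => ?_
  obtain ⟨y, rfl⟩ := D.mem_faces.mp hF
  have := D.length_faceOf_pos y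
  omega

lemma faceStep_eq_self_of_length {x : Fin n} (h : (D.faceOf x).length - 1 = 0) :
    D.faceStep x = x := by
  have h1 := D.length_faceOf_pos x
  have h2 : Function.minimalPeriod D.faceStep x = 1 := by rw [← length_faceOf]; omega
  exact Function.minimalPeriod_eq_one_iff_isFixedPt.mp h2

lemma of_length_two {x : Fin n} (h : (D.faceOf x).length = 2) :
    D.faceStep x ≠ x ∧ D.faceStep (D.faceStep x) = x ∧
      ∀ y, D.faceOf y = D.faceOf x → y = x ∨ y = D.faceStep x := by
  rw [length_faceOf] at h
  have h2 : D.faceStep (D.faceStep x) = x := by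
    have := Function.iterate_minimalPeriod (f := D.faceStep) (x := x)
    rwa [h] at this
  refine ⟨fun h1 => ?_, h2, fun y hy => ?_⟩
  · have := Function.minimalPeriod_eq_one_iff_isFixedPt.mpr (show Function.IsFixedPt D.faceStep x from h1)
    omega
  · obtain ⟨k, rfl⟩ := D.mem_faceOf.mp (D.faceOf_eq_iff.mp hy)
    rw [← Function.iterate_mod_minimalPeriod_eq, h]
    have : k % 2 < 2 := Nat.mod_lt _ (by norm_num)
    interval_cases k % 2
    · exact Or.inl rfl
    · exact Or.inr rfl

lemma of_length_three {x : Fin n} (h : (D.faceOf x).length = 3) :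
    D.faceStep x ≠ x ∧ D.faceStep (D.faceStep x) ≠ x ∧
      D.faceStep (D.faceStep (D.faceStep x)) = x ∧
      ∀ y, D.faceOf y = D.faceOf x → y = x ∨ y = D.faceStep x ∨ y = D.faceStep (D.faceStep x) := by
  rw [length_faceOf] at h
  have h3 : D.faceStep (D.faceStep (D.faceStep x)) = x := by
    have := Function.iterate_minimalPeriod (f := D.faceStep) (x := x)
    rwa [h] at this
  refine ⟨fun h1 => ?_, fun h1 => ?_, h3, fun y hy => ?_⟩
  · have := Function.minimalPeriod_eq_one_iff_isFixedPt.mpr (show Function.IsFixedPt D.faceStep x from h1)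
    omega
  · have := (show Function.IsPeriodicPt D.faceStep 2 x from h1).minimalPeriod_le (by norm_num)
    omega
  · obtain ⟨k, rfl⟩ := D.mem_faceOf.mp (D.faceOf_eq_iff.mp hy)
    rw [← Function.iterate_mod_minimalPeriod_eq, h]
    have : k % 3 < 3 := Nat.mod_lt _ (by norm_num)
    interval_cases k % 3
    · exact Or.inl rfl
    · exact Or.inr (Or.inl rfl)
    · exact Or.inr (Or.inr rfl)

/-- A toroidal dipole has, apart from digons, either one face with three corners at the root
vertex or two faces with two such corners. -/
theorem exists_faceStep_eq (h : D.faces.card + 2 = n) :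
    (∃ p q r, p < q ∧ q < r ∧ D.faceStep = threeCycle p q r) ∨
      ∃ a b c d, a < b ∧ b < c ∧ c < d ∧ D.faceStep = doubleSwap a b c d := by
  -- The total excess is 2: either one face has excess 2, or two faces have excess 1 each; all other
  -- corners are fixed by `faceStep`.
  have hsum : ∑ F ∈ D.faces, (F.length - 1) = 2 := by
    have := D.sum_length_sub_one
    omega
  have hcyc := D.isCycleOn_faceStep
  obtain ⟨F, hF, hF0⟩ : ∃ F ∈ D.faces, F.length - 1 ≠ 0 :=
    Finset.exists_ne_zero_of_sum_ne_zero (by omega)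
  rw [← Finset.add_sum_erase _ _ hF] at hsum
  obtain ⟨p, rfl⟩ := D.mem_faces.mp hF
  by_cases h3 : (D.faceOf p).length = 3
  · left
    obtain ⟨h1, h2, h4, h5⟩ := D.of_length_three h3
    have hrest : ∀ x, D.faceOf x ≠ D.faceOf p → D.faceStep x = x := by
      intro x hx
      refine D.faceStep_eq_self_of_length ?_
      have h0 : ∑ F ∈ D.faces.erase (D.faceOf p), (F.length - 1) = 0 := by omega
      refine Finset.sum_eq_zero_iff.mp h0 _ ?_
      exact Finset.mem_erase.mpr ⟨hx, D.mem_faces.mpr ⟨x, rfl⟩⟩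
    set q := D.faceStep p
    set r := D.faceStep q
    have hqr : q ≠ r := fun e => h1 (D.faceStep.injective e.symm)
    have heq : D.faceStep = threeCycle p q r := by
      refine Equiv.ext fun x => ?_
      rw [threeCycle_apply h1.symm hqr h2.symm]
      split_ifs with e1 e2 e3
      · rw [e1]
      · rw [e2]
      · rw [e3, h4]
      · refine hrest x fun e => ?_
        rcases h5 x e with e | e | e <;> contradiction
    rw [heq] at hcyc
    obtain ⟨p', q', r', k1, k2, k3⟩ := exists_lt_threeCycle h1.symm hqr h2.symm hcyc
    exact ⟨p', q', r', k1, k2, heq.trans k3⟩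
  · right
    have hlen : (D.faceOf p).length = 2 := by omega
    obtain ⟨h1, h2, h5⟩ := D.of_length_two hlen
    have hsum' : ∑ F ∈ D.faces.erase (D.faceOf p), (F.length - 1) = 1 := by omega
    obtain ⟨G, hG, hG0⟩ : ∃ G ∈ D.faces.erase (D.faceOf p), G.length - 1 ≠ 0 :=
      Finset.exists_ne_zero_of_sum_ne_zero (by omega)
    rw [← Finset.add_sum_erase _ _ hG] at hsum'
    obtain ⟨hGp, hG'⟩ := Finset.mem_erase.mp hG
    obtain ⟨q, rfl⟩ := D.mem_faces.mp hG'
    obtain ⟨k1, k2, k5⟩ := D.of_length_two (x := q) (by omega)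
    have hrest : ∀ x, D.faceOf x ≠ D.faceOf p → D.faceOf x ≠ D.faceOf q → D.faceStep x = x := by
      intro x hx hx'
      refine D.faceStep_eq_self_of_length ?_
      have h0 : ∑ F ∈ (D.faces.erase (D.faceOf p)).erase (D.faceOf q), (F.length - 1) = 0 := by
        omega
      refine Finset.sum_eq_zero_iff.mp h0 _ ?_
      exact Finset.mem_erase.mpr ⟨hx', Finset.mem_erase.mpr ⟨hx, D.mem_faces.mpr ⟨x, rfl⟩⟩⟩
    have hstep : ∀ x, D.faceOf (D.faceStep x) = D.faceOf x := fun x =>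
      Function.periodicOrbit_apply_eq (D.mem_periodicPts x)
    have hne : ∀ x y, D.faceOf x = D.faceOf p → D.faceOf y = D.faceOf q → x ≠ y := by
      rintro x y hx hy rfl
      exact hGp (hy.symm.trans hx)
    refine exists_lt_doubleSwap (a := p) (b := q) (c := D.faceStep p) (d := D.faceStep q) h1.symm
      k1.symm (hne _ _ rfl rfl) (hne _ _ rfl (hstep q)) (hne _ _ (hstep p) rfl)
      (hne _ _ (hstep p) (hstep q)) rfl rfl h2 k2 (fun x e1 e2 e3 e4 => ?_) hcyc
    refine hrest x (fun e => ?_) (fun e => ?_)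
    · rcases h5 x e with e | e <;> contradiction
    · rcases k5 x e with e | e <;> contradiction

end Dipole

/-! ### Explicit faces for the two shapes -/

namespace Dipole
variable {n : ℕ} (D : Dipole n)

lemma minimalPeriod_of_fixed {x : Fin n} (h : D.faceStep x = x) :
    Function.minimalPeriod D.faceStep x = 1 :=
  Function.minimalPeriod_eq_one_iff_isFixedPt.mpr h

lemma minimalPeriod_of_swap {x y : Fin n} (hxy : x ≠ y) (h1 : D.faceStep x = y)
    (h2 : D.faceStep y = x) : Function.minimalPeriod D.faceStep x = 2 := by
  have : Fact (Nat.Prime 2) := ⟨Nat.prime_two⟩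
  refine Function.minimalPeriod_eq_prime ?_ ?_
  · change D.faceStep (D.faceStep x) = x
    rw [h1, h2]
  · intro h
    exact hxy (h.symm.trans h1)

lemma minimalPeriod_of_three {x y z : Fin n} (hxy : x ≠ y) (h1 : D.faceStep x = y)
    (h2 : D.faceStep y = z) (h3 : D.faceStep z = x) :
    Function.minimalPeriod D.faceStep x = 3 := by
  have : Fact (Nat.Prime 3) := ⟨Nat.prime_three⟩
  refine Function.minimalPeriod_eq_prime ?_ ?_
  · change D.faceStep (D.faceStep (D.faceStep x)) = x
    rw [h1, h2, h3]
  · intro h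
    exact hxy (h.symm.trans h1)

lemma faceOf_of_fixed {x : Fin n} (h : D.faceStep x = x) : D.faceOf x = ([x] : Cycle (Fin n)) := by
  rw [faceOf, Function.periodicOrbit_def, D.minimalPeriod_of_fixed h]
  simp [List.range_succ]

lemma faceOf_of_swap {x y : Fin n} (hxy : x ≠ y) (h1 : D.faceStep x = y)
    (h2 : D.faceStep y = x) : D.faceOf x = ([x, y] : Cycle (Fin n)) := by
  rw [faceOf, Function.periodicOrbit_def, D.minimalPeriod_of_swap hxy h1 h2]
  simp [List.range_succ, h1]

lemma faceOf_of_three {x y z : Fin n} (hxy : x ≠ y) (h1 : D.faceStep x = y)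
    (h2 : D.faceStep y = z) (h3 : D.faceStep z = x) :
    D.faceOf x = ([x, y, z] : Cycle (Fin n)) := by
  rw [faceOf, Function.periodicOrbit_def, D.minimalPeriod_of_three hxy h1 h2 h3]
  simp [List.range_succ, h1, h2]

lemma faceOf_faceStep (x : Fin n) : D.faceOf (D.faceStep x) = D.faceOf x :=
  Function.periodicOrbit_apply_eq (D.mem_periodicPts x)

end Dipole

/-- The faces with a single corner at the root vertex, for a given set of such corners. -/
def singletonFaces {n : ℕ} (s : Finset (Fin n)) : Finset (Cycle (Fin n)) :=
  s.image fun x => ([x] : Cycle (Fin n))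

lemma singletonCycle_injective {n : ℕ} :
    Function.Injective fun x : Fin n => ([x] : Cycle (Fin n)) := by
  intro x y h
  simpa using Cycle.coe_eq_coe.mp h

lemma length_of_mem_singletonFaces {n : ℕ} {s : Finset (Fin n)} {F : Cycle (Fin n)}
    (h : F ∈ singletonFaces s) : F.length = 1 := by
  obtain ⟨x, -, rfl⟩ := Finset.mem_image.mp h
  rfl

lemma prod_singletonFaces {M : Type*} [CommMonoid M] {n : ℕ} (s : Finset (Fin n))
    (w : Cycle (Fin n) → M) : ∏ F ∈ singletonFaces s, w F = ∏ x ∈ s, w ([x] : Cycle (Fin n)) :=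
  Finset.prod_image fun _ _ _ _ h => singletonCycle_injective h

lemma map_length_singletonFaces {n : ℕ} (s : Finset (Fin n)) :
    (singletonFaces s).val.map Cycle.length = Multiset.replicate s.card 1 := by
  rw [Multiset.eq_replicate]
  refine ⟨?_, fun k hk => ?_⟩
  · rw [Multiset.card_map, Finset.card_val, singletonFaces,
      Finset.card_image_of_injective _ singletonCycle_injective]
  · obtain ⟨F, hF, rfl⟩ := Multiset.mem_map.mp hk
    exact length_of_mem_singletonFaces hF

namespace Dipole
variable {n : ℕ} (D : Dipole n)

section three
variable {p q r : Fin n}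

/-- The non-membership clause lets sums and products over the faces be split along `insert`. -/
lemma faces_threeCycle (hpq : p < q) (hqr : q < r) (h : D.faceStep = threeCycle p q r) :
    ([p, q, r] : Cycle (Fin n)) ∉ singletonFaces ({p, q, r}ᶜ : Finset (Fin n)) ∧
    D.faces = insert ([p, q, r] : Cycle (Fin n)) (singletonFaces ({p, q, r}ᶜ : Finset (Fin n))) ∧
    D.faceOf p = ([p, q, r] : Cycle (Fin n)) := by
  have happ := fun x => DFunLike.congr_fun h x
  simp only [threeCycle_apply hpq.ne hqr.ne (hpq.trans hqr).ne] at happ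
  have e1 : D.faceStep p = q := by simp [happ]
  have e2 : D.faceStep q = r := by simp [happ, hpq.ne']
  have e3 : D.faceStep r = p := by simp [happ, hqr.ne', (hpq.trans hqr).ne']
  have hp := D.faceOf_of_three hpq.ne e1 e2 e3
  have hq : D.faceOf q = D.faceOf p := by rw [← e1, faceOf_faceStep]
  have hr : D.faceOf r = D.faceOf p := by rw [← e2, faceOf_faceStep, hq]
  have hx : ∀ x, x ≠ p → x ≠ q → x ≠ r → D.faceOf x = ([x] : Cycle (Fin n)) := by
    intro x h1 h2 h3
    exact D.faceOf_of_fixed (by simp [happ, h1, h2, h3])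
  refine ⟨fun hm => by simpa using length_of_mem_singletonFaces hm, ?_, hp⟩
  ext F
  simp only [mem_faces, Finset.mem_insert, singletonFaces, Finset.mem_image, Finset.mem_compl,
    Finset.mem_singleton, not_or]
  constructor
  · rintro ⟨x, rfl⟩
    by_cases h1 : x = p
    · exact Or.inl (by rw [h1, hp])
    by_cases h2 : x = q
    · exact Or.inl (by rw [h2, hq, hp])
    by_cases h3 : x = r
    · exact Or.inl (by rw [h3, hr, hp])
    · exact Or.inr ⟨x, ⟨h1, h2, h3⟩, (hx x h1 h2 h3).symm⟩
  · rintro (rfl | ⟨x, ⟨h1, h2, h3⟩, rfl⟩)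
    · exact ⟨p, hp⟩
    · exact ⟨x, hx x h1 h2 h3⟩

lemma card_compl_three (hpq : p < q) (hqr : q < r) :
    ({p, q, r}ᶜ : Finset (Fin n)).card = n - 3 := by
  rw [Finset.card_compl, Fintype.card_fin, Finset.card_eq_three.mpr
    ⟨p, q, r, hpq.ne, (hpq.trans hqr).ne, hqr.ne, rfl⟩]

lemma halfFaceDegrees_threeCycle (hpq : p < q) (hqr : q < r)
    (h : D.faceStep = threeCycle p q r) : D.halfFaceDegrees = hook3 n := by
  obtain ⟨h1, h2, -⟩ := D.faces_threeCycle hpq hqr h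
  rw [halfFaceDegrees, h2, Finset.insert_val_of_notMem h1, Multiset.map_cons,
    map_length_singletonFaces, card_compl_three hpq hqr]
  rfl

/-- Multiplying by the weights of the three missing digons completes the product to one over all
corners, which depends only on the numbers of black and white corners. The factors are cancelled
later. -/
lemma prod_faces_threeCycle {M : Type*} [CommMonoid M] (hpq : p < q) (hqr : q < r)
    (h : D.faceStep = threeCycle p q r) (w : Cycle (Fin n) → M) :
    (∏ F ∈ D.faces, w F) * (w ([p] : Cycle (Fin n)) * w ([q] : Cycle (Fin n)) *
      w ([r] : Cycle (Fin n))) =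
      w ([p, q, r] : Cycle (Fin n)) * ∏ x : Fin n, w ([x] : Cycle (Fin n)) := by
  obtain ⟨h1, h2, -⟩ := D.faces_threeCycle hpq hqr h
  rw [h2, Finset.prod_insert h1, prod_singletonFaces,
    ← Finset.prod_compl_mul_prod ({p, q, r} : Finset (Fin n)),
    Finset.prod_insert (by simp [hpq.ne, (hpq.trans hqr).ne]), Finset.prod_pair hqr.ne]
  simp only [mul_assoc]

end three

section double
variable {a b c d : Fin n}

lemma faces_doubleSwap (hab : a < b) (hbc : b < c) (hcd : c < d)
    (h : D.faceStep = doubleSwap a b c d) :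
    ([b, d] : Cycle (Fin n)) ∉ singletonFaces ({a, b, c, d}ᶜ : Finset (Fin n)) ∧
    ([a, c] : Cycle (Fin n)) ∉
      insert ([b, d] : Cycle (Fin n)) (singletonFaces ({a, b, c, d}ᶜ : Finset (Fin n))) ∧
    D.faces = insert ([a, c] : Cycle (Fin n)) (insert ([b, d] : Cycle (Fin n))
      (singletonFaces ({a, b, c, d}ᶜ : Finset (Fin n)))) ∧
    D.faceOf a = ([a, c] : Cycle (Fin n)) := by
  have happ := fun x => DFunLike.congr_fun h x
  simp only [doubleSwap_apply hab hbc hcd] at happ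
  have hac := hab.trans hbc
  have hbd := hbc.trans hcd
  have e1 : D.faceStep a = c := by simp [happ]
  have e2 : D.faceStep b = d := by simp [happ, hab.ne']
  have e3 : D.faceStep c = a := by simp [happ, hac.ne', hbc.ne']
  have e4 : D.faceStep d = b := by simp [happ, hcd.ne', hbd.ne', (hac.trans hcd).ne']
  have ha := D.faceOf_of_swap hac.ne e1 e3
  have hb := D.faceOf_of_swap hbd.ne e2 e4
  have hc : D.faceOf c = D.faceOf a := by rw [← e1, faceOf_faceStep]
  have hd : D.faceOf d = D.faceOf b := by rw [← e2, faceOf_faceStep]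
  have hx : ∀ x, x ≠ a → x ≠ b → x ≠ c → x ≠ d → D.faceOf x = ([x] : Cycle (Fin n)) := by
    intro x h1 h2 h3 h4
    exact D.faceOf_of_fixed (by simp [happ, h1, h2, h3, h4])
  have hne : ([a, c] : Cycle (Fin n)) ≠ ([b, d] : Cycle (Fin n)) := by
    intro he
    have h1 : a ∈ ([a, c] : Cycle (Fin n)) := Cycle.mem_coe_iff.mpr (by simp)
    rw [he, Cycle.mem_coe_iff] at h1
    simp [hab.ne, (hac.trans hcd).ne] at h1
  refine ⟨fun hm => by simpa using length_of_mem_singletonFaces hm, fun hm => ?_, ?_, ha⟩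
  · rcases Finset.mem_insert.mp hm with hm | hm
    · exact hne hm
    · simpa using length_of_mem_singletonFaces hm
  ext F
  simp only [mem_faces, Finset.mem_insert, singletonFaces, Finset.mem_image, Finset.mem_compl,
    Finset.mem_singleton, not_or]
  constructor
  · rintro ⟨x, rfl⟩
    by_cases h1 : x = a
    · exact Or.inl (by rw [h1, ha])
    by_cases h2 : x = b
    · exact Or.inr (Or.inl (by rw [h2, hb]))
    by_cases h3 : x = c
    · exact Or.inl (by rw [h3, hc, ha])
    by_cases h4 : x = d
    · exact Or.inr (Or.inl (by rw [h4, hd, hb]))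
    · exact Or.inr (Or.inr ⟨x, ⟨h1, h2, h3, h4⟩, (hx x h1 h2 h3 h4).symm⟩)
  · rintro (rfl | rfl | ⟨x, ⟨h1, h2, h3, h4⟩, rfl⟩)
    · exact ⟨a, ha⟩
    · exact ⟨b, hb⟩
    · exact ⟨x, hx x h1 h2 h3 h4⟩

lemma card_compl_four (hab : a < b) (hbc : b < c) (hcd : c < d) :
    ({a, b, c, d}ᶜ : Finset (Fin n)).card = n - 4 := by
  rw [Finset.card_compl, Fintype.card_fin, Finset.card_insert_of_notMem,
    Finset.card_eq_three.mpr ⟨b, c, d, hbc.ne, (hbc.trans hcd).ne, hcd.ne, rfl⟩]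
  simp [hab.ne, (hab.trans hbc).ne, (hab.trans (hbc.trans hcd)).ne]

lemma halfFaceDegrees_doubleSwap (hab : a < b) (hbc : b < c) (hcd : c < d)
    (h : D.faceStep = doubleSwap a b c d) : D.halfFaceDegrees = doubleTwo n := by
  obtain ⟨h1, h2, h3, -⟩ := D.faces_doubleSwap hab hbc hcd h
  rw [halfFaceDegrees, h3, Finset.insert_val_of_notMem h2, Finset.insert_val_of_notMem h1,
    Multiset.map_cons, Multiset.map_cons, map_length_singletonFaces, card_compl_four hab hbc hcd]
  rfl

lemma prod_faces_doubleSwap {M : Type*} [CommMonoid M] (hab : a < b) (hbc : b < c) (hcd : c < d)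
    (h : D.faceStep = doubleSwap a b c d) (w : Cycle (Fin n) → M) :
    (∏ F ∈ D.faces, w F) * (w ([a] : Cycle (Fin n)) * w ([b] : Cycle (Fin n)) *
      w ([c] : Cycle (Fin n)) * w ([d] : Cycle (Fin n))) =
      w ([a, c] : Cycle (Fin n)) * w ([b, d] : Cycle (Fin n)) *
        ∏ x : Fin n, w ([x] : Cycle (Fin n)) := by
  obtain ⟨h1, h2, h3, -⟩ := D.faces_doubleSwap hab hbc hcd h
  rw [h3, Finset.prod_insert h2, Finset.prod_insert h1, prod_singletonFaces,
    ← Finset.prod_compl_mul_prod ({a, b, c, d} : Finset (Fin n)),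
    Finset.prod_insert (by simp [hab.ne, (hab.trans hbc).ne, (hab.trans (hbc.trans hcd)).ne]),
    Finset.prod_insert (by simp [hbc.ne, (hbc.trans hcd).ne]), Finset.prod_pair hcd.ne]
  simp only [mul_assoc]

end double

lemma card_halfFaceDegrees : Multiset.card D.halfFaceDegrees = D.faces.card := by
  simp [halfFaceDegrees]

/-- The partition has `n - 2` parts, so the classification applies, and the part 3 rules out two
transpositions. -/
lemma halfFaceDegrees_eq_hook3_iff (hn : 3 ≤ n) : D.halfFaceDegrees = hook3 n ↔
    ∃ p q r, p < q ∧ q < r ∧ D.faceStep = threeCycle p q r := by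
  constructor
  · intro h
    have hc := D.card_halfFaceDegrees
    rw [h, hook3, Multiset.card_cons, Multiset.card_replicate] at hc
    rcases D.exists_faceStep_eq (by omega) with h1 | ⟨a, b, c, d, h1, h2, h3, h4⟩
    · exact h1
    · rw [D.halfFaceDegrees_doubleSwap h1 h2 h3 h4] at h
      have : 3 ∈ doubleTwo n := h ▸ Multiset.mem_cons_self 3 _
      simp [doubleTwo, Multiset.mem_replicate] at this
  · rintro ⟨p, q, r, h1, h2, h3⟩
    exact D.halfFaceDegrees_threeCycle h1 h2 h3

lemma halfFaceDegrees_eq_doubleTwo_iff (hn : 4 ≤ n) : D.halfFaceDegrees = doubleTwo n ↔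
    ∃ a b c d, a < b ∧ b < c ∧ c < d ∧ D.faceStep = doubleSwap a b c d := by
  constructor
  · intro h
    have hc := D.card_halfFaceDegrees
    rw [h, doubleTwo, Multiset.card_cons, Multiset.card_cons, Multiset.card_replicate] at hc
    rcases D.exists_faceStep_eq (by omega) with ⟨p, q, r, h1, h2, h3⟩ | h1
    · rw [D.halfFaceDegrees_threeCycle h1 h2 h3] at h
      have : 3 ∈ doubleTwo n := h ▸ Multiset.mem_cons_self 3 _
      simp [doubleTwo, Multiset.mem_replicate] at this
    · exact h1
  · rintro ⟨a, b, c, d, h1, h2, h3, h4⟩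
    exact D.halfFaceDegrees_doubleSwap h1 h2 h3 h4

lemma card_faces_add_two_iff : D.faces.card + 2 = n ↔
    (∃ p q r, p < q ∧ q < r ∧ D.faceStep = threeCycle p q r) ∨
      ∃ a b c d, a < b ∧ b < c ∧ c < d ∧ D.faceStep = doubleSwap a b c d := by
  refine ⟨D.exists_faceStep_eq, ?_⟩
  rw [← card_halfFaceDegrees]
  rintro (⟨p, q, r, h1, h2, h3⟩ | ⟨a, b, c, d, h1, h2, h3, h4⟩)
  · rw [D.halfFaceDegrees_threeCycle h1 h2 h3, hook3, Multiset.card_cons,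
      Multiset.card_replicate]
    omega
  · rw [D.halfFaceDegrees_doubleSwap h1 h2 h3 h4, doubleTwo, Multiset.card_cons,
      Multiset.card_cons, Multiset.card_replicate]
    omega

end Dipole

/-! ### Counting toroidal dipoles by increasing triples and quadruples -/

section counting
variable {n : ℕ}

/-- The increasing triples with a given property. -/
def increasingTriples (n : ℕ) (Q : Fin n → Fin n → Fin n → Prop) :
    Finset (Fin n × Fin n × Fin n) :=
  Finset.univ.filter fun t => t.1 < t.2.1 ∧ t.2.1 < t.2.2 ∧ Q t.1 t.2.1 t.2.2

/-- The increasing quadruples with a given property. -/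
def increasingQuadruples (n : ℕ) (Q : Fin n → Fin n → Fin n → Fin n → Prop) :
    Finset (Fin n × Fin n × Fin n × Fin n) :=
  Finset.univ.filter fun t => t.1 < t.2.1 ∧ t.2.1 < t.2.2.1 ∧ t.2.2.1 < t.2.2.2 ∧
    Q t.1 t.2.1 t.2.2.1 t.2.2.2

lemma triple_eq_of_mem {p q r p' q' r' : Fin n} (h1 : p < q) (h2 : q < r) (h1' : p' < q')
    (h2' : q' < r') (hp : p' = p ∨ p' = q ∨ p' = r) (hq : q' = p ∨ q' = q ∨ q' = r)
    (hr : r' = p ∨ r' = q ∨ r' = r) : p = p' ∧ q = q' ∧ r = r' := by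
  omega

lemma quadruple_eq_of_mem {a b c d a' b' c' d' : Fin n} (h1 : a < b) (h2 : b < c) (h3 : c < d)
    (h1' : a' < b') (h2' : b' < c') (h3' : c' < d')
    (ha : a' = a ∨ a' = b ∨ a' = c ∨ a' = d) (hb : b' = a ∨ b' = b ∨ b' = c ∨ b' = d)
    (hc : c' = a ∨ c' = b ∨ c' = c ∨ c' = d) (hd : d' = a ∨ d' = b ∨ d' = c ∨ d' = d) :
    a = a' ∧ b = b' ∧ c = c' ∧ d = d' := by
  omega

lemma threeCycle_ne_self_iff {p q r : Fin n} (hpq : p < q) (hqr : q < r) (x : Fin n) :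
    threeCycle p q r x ≠ x ↔ x = p ∨ x = q ∨ x = r := by
  rw [threeCycle_apply hpq.ne hqr.ne (hpq.trans hqr).ne]
  split_ifs <;> omega

lemma doubleSwap_ne_self_iff {a b c d : Fin n} (hab : a < b) (hbc : b < c) (hcd : c < d)
    (x : Fin n) : doubleSwap a b c d x ≠ x ↔ x = a ∨ x = b ∨ x = c ∨ x = d := by
  rw [doubleSwap_apply hab hbc hcd]
  split_ifs <;> omega

/-- The set of moved corners determines the increasing triple. -/
lemma threeCycle_inj {p q r p' q' r' : Fin n} (h1 : p < q) (h2 : q < r) (h1' : p' < q')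
    (h2' : q' < r') (h : threeCycle p q r = threeCycle p' q' r') : p = p' ∧ q = q' ∧ r = r' := by
  have key : ∀ x, x = p' ∨ x = q' ∨ x = r' → x = p ∨ x = q ∨ x = r := fun x hx => by
    rw [← threeCycle_ne_self_iff h1' h2', ← h] at hx
    exact (threeCycle_ne_self_iff h1 h2 x).mp hx
  exact triple_eq_of_mem h1 h2 h1' h2' (key _ (by simp)) (key _ (by simp)) (key _ (by simp))

lemma doubleSwap_inj {a b c d a' b' c' d' : Fin n} (h1 : a < b) (h2 : b < c) (h3 : c < d)
    (h1' : a' < b') (h2' : b' < c') (h3' : c' < d')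
    (h : doubleSwap a b c d = doubleSwap a' b' c' d') :
    a = a' ∧ b = b' ∧ c = c' ∧ d = d' := by
  have key : ∀ x, x = a' ∨ x = b' ∨ x = c' ∨ x = d' → x = a ∨ x = b ∨ x = c ∨ x = d :=
    fun x hx => by
      rw [← doubleSwap_ne_self_iff h1' h2' h3', ← h] at hx
      exact (doubleSwap_ne_self_iff h1 h2 h3 x).mp hx
  exact quadruple_eq_of_mem h1 h2 h3 h1' h2' h3' (key _ (by simp)) (key _ (by simp))
    (key _ (by simp)) (key _ (by simp))

lemma mem_increasingTriples {Q : Fin n → Fin n → Fin n → Prop} {t : Fin n × Fin n × Fin n} :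
    t ∈ increasingTriples n Q ↔ t.1 < t.2.1 ∧ t.2.1 < t.2.2 ∧ Q t.1 t.2.1 t.2.2 := by
  simp [increasingTriples]

lemma mem_increasingQuadruples {Q : Fin n → Fin n → Fin n → Fin n → Prop}
    {t : Fin n × Fin n × Fin n × Fin n} :
    t ∈ increasingQuadruples n Q ↔ t.1 < t.2.1 ∧ t.2.1 < t.2.2.1 ∧ t.2.2.1 < t.2.2.2 ∧
      Q t.1 t.2.1 t.2.2.1 t.2.2.2 := by
  simp [increasingQuadruples]

/-- The side condition `Q` lets this one bijection serve both for `psi` and for the sums with a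
prescribed image of the root corner. -/
lemma card_dipole_threeCycle (Q : Fin n → Fin n → Fin n → Prop) :
    (Finset.univ.filter fun D : Dipole n => ∃ p q r, p < q ∧ q < r ∧
      D.faceStep = threeCycle p q r ∧ Q p q r).card = (increasingTriples n Q).card := by
  symm
  refine Finset.card_bij
    (fun t ht => Dipole.ofFaceStep (threeCycle t.1 t.2.1 t.2.2) t.1.pos
      (isCycleOn_threeCycle (mem_increasingTriples.mp ht).1 (mem_increasingTriples.mp ht).2.1))
    ?_ ?_ ?_
  · intro t ht
    obtain ⟨h1, h2, h3⟩ := mem_increasingTriples.mp ht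
    exact Finset.mem_filter.mpr ⟨Finset.mem_univ _, _, _, _, h1, h2, by simp, h3⟩
  · intro t ht t' ht' h
    obtain ⟨h1, h2, h3⟩ := mem_increasingTriples.mp ht
    obtain ⟨h1', h2', h3'⟩ := mem_increasingTriples.mp ht'
    have := congrArg Dipole.faceStep h
    simp only [Dipole.faceStep_ofFaceStep] at this
    obtain ⟨e1, e2, e3⟩ := threeCycle_inj h1 h2 h1' h2' this
    exact Prod.ext e1 (Prod.ext e2 e3)
  · intro D hD
    obtain ⟨-, p, q, r, h1, h2, h3, h4⟩ := Finset.mem_filter.mp hD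
    refine ⟨(p, q, r), mem_increasingTriples.mpr ⟨h1, h2, h4⟩, ?_⟩
    exact Dipole.faceStep_injective (by simp [h3])

lemma card_dipole_doubleSwap (Q : Fin n → Fin n → Fin n → Fin n → Prop) :
    (Finset.univ.filter fun D : Dipole n => ∃ a b c d, a < b ∧ b < c ∧ c < d ∧
      D.faceStep = doubleSwap a b c d ∧ Q a b c d).card = (increasingQuadruples n Q).card := by
  symm
  refine Finset.card_bij
    (fun t ht => Dipole.ofFaceStep (doubleSwap t.1 t.2.1 t.2.2.1 t.2.2.2) t.1.pos
      (isCycleOn_doubleSwap (mem_increasingQuadruples.mp ht).1 (mem_increasingQuadruples.mp ht).2.1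
        (mem_increasingQuadruples.mp ht).2.2.1))
    ?_ ?_ ?_
  · intro t ht
    obtain ⟨h1, h2, h3, h4⟩ := mem_increasingQuadruples.mp ht
    exact Finset.mem_filter.mpr ⟨Finset.mem_univ _, _, _, _, _, h1, h2, h3, by simp, h4⟩
  · intro t ht t' ht' h
    obtain ⟨h1, h2, h3, -⟩ := mem_increasingQuadruples.mp ht
    obtain ⟨h1', h2', h3', -⟩ := mem_increasingQuadruples.mp ht'
    have := congrArg Dipole.faceStep h
    simp only [Dipole.faceStep_ofFaceStep] at this
    obtain ⟨e1, e2, e3, e4⟩ := doubleSwap_inj h1 h2 h3 h1' h2' h3' this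
    exact Prod.ext e1 (Prod.ext e2 (Prod.ext e3 e4))
  · intro D hD
    obtain ⟨-, a, b, c, d, h1, h2, h3, h4, h5⟩ := Finset.mem_filter.mp hD
    refine ⟨(a, b, c, d), mem_increasingQuadruples.mpr ⟨h1, h2, h3, h5⟩, ?_⟩
    exact Dipole.faceStep_injective (by simp [h4])

lemma card_increasingTriples_mem (s : Finset (Fin n)) :
    (increasingTriples n fun p q r => p ∈ s ∧ q ∈ s ∧ r ∈ s).card = s.card.choose 3 := by
  rw [← Finset.card_powersetCard]
  refine Finset.card_bij (fun t _ => {t.1, t.2.1, t.2.2}) ?_ ?_ ?_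
  · intro t ht
    obtain ⟨h1, h2, h3, h4, h5⟩ := mem_increasingTriples.mp ht
    refine Finset.mem_powersetCard.mpr ⟨?_, Finset.card_eq_three.mpr
      ⟨_, _, _, h1.ne, (h1.trans h2).ne, h2.ne, rfl⟩⟩
    simp [Finset.insert_subset_iff, h3, h4, h5]
  · intro t ht t' ht' h
    obtain ⟨h1, h2, -⟩ := mem_increasingTriples.mp ht
    obtain ⟨h1', h2', -⟩ := mem_increasingTriples.mp ht'
    have key : ∀ x, x = t'.1 ∨ x = t'.2.1 ∨ x = t'.2.2 → x = t.1 ∨ x = t.2.1 ∨ x = t.2.2 :=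
      fun x hx => by simpa using (congrArg (x ∈ ·) h).mpr (by simpa using hx)
    obtain ⟨e1, e2, e3⟩ := triple_eq_of_mem h1 h2 h1' h2' (key _ (by simp)) (key _ (by simp))
      (key _ (by simp))
    exact Prod.ext e1 (Prod.ext e2 e3)
  · intro u hu
    obtain ⟨hus, hu⟩ := Finset.mem_powersetCard.mp hu
    have hmem := u.orderEmbOfFin_mem hu
    have hlt : ∀ i j : Fin 3, i < j → u.orderEmbOfFin hu i < u.orderEmbOfFin hu j :=
      fun i j h => (u.orderEmbOfFin hu).strictMono h
    have h01 := hlt 0 1 (by decide)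
    have h12 := hlt 1 2 (by decide)
    refine ⟨(u.orderEmbOfFin hu 0, u.orderEmbOfFin hu 1, u.orderEmbOfFin hu 2),
      mem_increasingTriples.mpr ⟨h01, h12, hus (hmem _), hus (hmem _),
        hus (hmem _)⟩, ?_⟩
    refine Finset.eq_of_subset_of_card_le (by simp [Finset.insert_subset_iff, hmem]) ?_
    rw [hu, Finset.card_eq_three.mpr ⟨_, _, _, h01.ne, (h01.trans h12).ne, h12.ne, rfl⟩]

lemma card_increasingQuadruples_mem (s : Finset (Fin n)) :
    (increasingQuadruples n fun a b c d => a ∈ s ∧ b ∈ s ∧ c ∈ s ∧ d ∈ s).card =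
      s.card.choose 4 := by
  rw [← Finset.card_powersetCard]
  have hcard : ∀ a b c d : Fin n, a < b → b < c → c < d →
      ({a, b, c, d} : Finset (Fin n)).card = 4 := fun a b c d h1 h2 h3 => by
    rw [Finset.card_insert_of_notMem, Finset.card_eq_three.mpr
      ⟨b, c, d, h2.ne, (h2.trans h3).ne, h3.ne, rfl⟩]
    simp [h1.ne, (h1.trans h2).ne, (h1.trans (h2.trans h3)).ne]
  refine Finset.card_bij (fun t _ => {t.1, t.2.1, t.2.2.1, t.2.2.2}) ?_ ?_ ?_
  · intro t ht
    obtain ⟨h1, h2, h3, h4, h5, h6, h7⟩ := mem_increasingQuadruples.mp ht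
    refine Finset.mem_powersetCard.mpr ⟨?_, hcard _ _ _ _ h1 h2 h3⟩
    simp [Finset.insert_subset_iff, h4, h5, h6, h7]
  · intro t ht t' ht' h
    obtain ⟨h1, h2, h3, -⟩ := mem_increasingQuadruples.mp ht
    obtain ⟨h1', h2', h3', -⟩ := mem_increasingQuadruples.mp ht'
    have key : ∀ x, x = t'.1 ∨ x = t'.2.1 ∨ x = t'.2.2.1 ∨ x = t'.2.2.2 →
        x = t.1 ∨ x = t.2.1 ∨ x = t.2.2.1 ∨ x = t.2.2.2 :=
      fun x hx => by simpa using (congrArg (x ∈ ·) h).mpr (by simpa using hx)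
    obtain ⟨e1, e2, e3, e4⟩ := quadruple_eq_of_mem h1 h2 h3 h1' h2' h3' (key _ (by simp))
      (key _ (by simp)) (key _ (by simp)) (key _ (by simp))
    exact Prod.ext e1 (Prod.ext e2 (Prod.ext e3 e4))
  · intro u hu
    obtain ⟨hus, hu⟩ := Finset.mem_powersetCard.mp hu
    have hmem := u.orderEmbOfFin_mem hu
    have hlt : ∀ i j : Fin 4, i < j → u.orderEmbOfFin hu i < u.orderEmbOfFin hu j :=
      fun i j h => (u.orderEmbOfFin hu).strictMono h
    have h01 := hlt 0 1 (by decide)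
    have h12 := hlt 1 2 (by decide)
    have h23 := hlt 2 3 (by decide)
    refine ⟨(u.orderEmbOfFin hu 0, u.orderEmbOfFin hu 1, u.orderEmbOfFin hu 2,
      u.orderEmbOfFin hu 3), mem_increasingQuadruples.mpr ⟨h01, h12, h23,
        hus (hmem _), hus (hmem _), hus (hmem _), hus (hmem _)⟩, ?_⟩
    refine Finset.eq_of_subset_of_card_le (by simp [Finset.insert_subset_iff, hmem]) ?_
    rw [hu, hcard _ _ _ _ h01 h12 h23]

/-- The number of rooted toroidal dipoles with one face of degree 6 and digons otherwise. -/
theorem psi_hook3 (hn : 3 ≤ n) : psi n (hook3 n) = n.choose 3 := by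
  have h := card_increasingTriples_mem (Finset.univ : Finset (Fin n))
  rw [← card_dipole_threeCycle, Finset.card_univ, Fintype.card_fin] at h
  rw [← h, psi]
  congr 1
  ext D
  simp [D.halfFaceDegrees_eq_hook3_iff hn]

/-- The number of rooted toroidal dipoles with two faces of degree 4 and digons otherwise. -/
theorem psi_doubleTwo (hn : 4 ≤ n) : psi n (doubleTwo n) = n.choose 4 := by
  have h := card_increasingQuadruples_mem (Finset.univ : Finset (Fin n))
  rw [← card_dipole_doubleSwap, Finset.card_univ, Fintype.card_fin] at h
  rw [← h, psi]
  congr 1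
  ext D
  simp [D.halfFaceDegrees_eq_doubleTwo_iff hn]

lemma card_increasingTriples_first (z y : Fin n) (hzy : z < y) :
    (increasingTriples n fun p q _ => p = z ∧ q = y).card = n - 1 - y := by
  rw [← Fin.card_Ioi]
  refine Finset.card_bij (fun t _ => t.2.2) ?_ ?_ ?_
  · intro t ht
    obtain ⟨h1, h2, h3, h4⟩ := mem_increasingTriples.mp ht
    exact Finset.mem_Ioi.mpr (h4 ▸ h2)
  · intro t ht t' ht' h
    obtain ⟨-, -, h3, h4⟩ := mem_increasingTriples.mp ht
    obtain ⟨-, -, h3', h4'⟩ := mem_increasingTriples.mp ht'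
    exact Prod.ext (h3.trans h3'.symm) (Prod.ext (h4.trans h4'.symm) h)
  · intro x hx
    exact ⟨(z, y, x), mem_increasingTriples.mpr ⟨hzy, Finset.mem_Ioi.mp hx, rfl, rfl⟩, rfl⟩

/-- Crossing puts `b` strictly between `z` and `y`, and `d` above `y`; the two choices are
independent. -/
lemma card_increasingQuadruples_odd (z y : Fin n) :
    (increasingQuadruples n fun a _ c _ => a = z ∧ c = y).card =
      (y - z - 1) * (n - 1 - y) := by
  rw [← Fin.card_Ioi, ← Fin.card_Ioo, ← Finset.card_product]
  refine Finset.card_bij (fun t _ => (t.2.1, t.2.2.2)) ?_ ?_ ?_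
  · intro t ht
    obtain ⟨h1, h2, h3, h4, h5⟩ := mem_increasingQuadruples.mp ht
    exact Finset.mem_product.mpr ⟨Finset.mem_Ioo.mpr ⟨h4 ▸ h1, h5 ▸ h2⟩,
      Finset.mem_Ioi.mpr (h5 ▸ h3)⟩
  · intro t ht t' ht' h
    obtain ⟨-, -, -, h3, h4⟩ := mem_increasingQuadruples.mp ht
    obtain ⟨-, -, -, h3', h4'⟩ := mem_increasingQuadruples.mp ht'
    obtain ⟨e1, e2⟩ := Prod.mk.inj h
    exact Prod.ext (h3.trans h3'.symm) (Prod.ext e1 (Prod.ext (h4.trans h4'.symm) e2))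
  · rintro ⟨x, x'⟩ hx
    obtain ⟨h1, h2⟩ := Finset.mem_product.mp hx
    obtain ⟨h3, h4⟩ := Finset.mem_Ioo.mp h1
    exact ⟨(z, x, y, x'), mem_increasingQuadruples.mpr ⟨h3, h4, Finset.mem_Ioi.mp h2, rfl, rfl⟩, rfl⟩

end counting

/-! ### Evaluating sums of reciprocal binomial coefficients -/

section reciprocalBinomials

/-- The linear form `∑ₖ binom(N,k)⁻¹ [y^k] p`. -/
def reciprocalBinomialSum (N : ℕ) (p : PowerSeries ℚ) : ℚ :=
  ∑ k ∈ Finset.range (N + 1), (N.choose k : ℚ)⁻¹ * PowerSeries.coeff k p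

/-- Since `1 / binom(N,k)` is `N + 1` times the integral of `t^k (1-t)^(N-k)` over `[0,1]`, this is
`t + (1 - t) = 1` under the integral. The proof uses the two absorption identities for binomial
coefficients instead. -/
lemma inv_choose_add_inv_choose {m k : ℕ} (hk : k ≤ m) :
    ((m + 1).choose k : ℚ)⁻¹ + ((m + 1).choose (k + 1) : ℚ)⁻¹ =
      ((m : ℚ) + 2) / (m + 1) * (m.choose k : ℚ)⁻¹ := by
  obtain ⟨l, rfl⟩ := Nat.exists_eq_add_of_le hk
  have h0 : ((k + l).choose k : ℚ) ≠ 0 := by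
    exact_mod_cast (Nat.choose_pos (Nat.le_add_right k l)).ne'
  have h1 : ((k + l + 1).choose k : ℚ) * (l + 1) = (k + l).choose k * (k + l + 1) := by
    have := Nat.choose_mul_succ_eq (k + l) k
    rw [show k + l + 1 - k = l + 1 by omega] at this
    exact_mod_cast this.symm
  have h2 : ((k + l + 1).choose (k + 1) : ℚ) * (k + 1) = (k + l).choose k * (k + l + 1) := by
    have := Nat.add_one_mul_choose_eq (k + l) k
    rw [mul_comm] at this
    exact_mod_cast this.symm
  have hl : ((l : ℚ) + 1) ≠ 0 := by positivity
  have hk : ((k : ℚ) + 1) ≠ 0 := by positivity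
  have hkl : ((k : ℚ) + l + 1) ≠ 0 := by positivity
  rw [eq_div_of_mul_eq hl h1, eq_div_of_mul_eq hk h2]
  push_cast
  field_simp
  ring

/-- Collecting the terms at each coefficient of `p` produces sums of two adjacent reciprocals. The
degree bound removes the coefficient at `m + 1`, which has no partner. -/
lemma reciprocalBinomialSum_one_add_X_mul {m : ℕ} {p : PowerSeries ℚ}
    (hp : ∀ k, m < k → PowerSeries.coeff k p = 0) :
    reciprocalBinomialSum (m + 1) ((1 + PowerSeries.X) * p) =
      ((m : ℚ) + 2) / (m + 1) * reciprocalBinomialSum m p := by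
  have h1 : reciprocalBinomialSum (m + 1) p =
      ∑ k ∈ Finset.range (m + 1), ((m + 1).choose k : ℚ)⁻¹ * PowerSeries.coeff k p := by
    rw [reciprocalBinomialSum, Finset.sum_range_succ, hp _ (Nat.lt_succ_self m), mul_zero, add_zero]
  have h2 : reciprocalBinomialSum (m + 1) (PowerSeries.X * p) =
      ∑ k ∈ Finset.range (m + 1), ((m + 1).choose (k + 1) : ℚ)⁻¹ * PowerSeries.coeff k p := by
    rw [reciprocalBinomialSum, Finset.sum_range_succ']
    simp [PowerSeries.coeff_succ_X_mul]
  have h3 : reciprocalBinomialSum (m + 1) ((1 + PowerSeries.X) * p) =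
      reciprocalBinomialSum (m + 1) p + reciprocalBinomialSum (m + 1) (PowerSeries.X * p) := by
    simp [reciprocalBinomialSum, add_mul, mul_add, Finset.sum_add_distrib]
  rw [h3, h1, h2, ← Finset.sum_add_distrib, reciprocalBinomialSum, Finset.mul_sum]
  refine Finset.sum_congr rfl fun k hk => ?_
  rw [← add_mul, inv_choose_add_inv_choose (Nat.lt_succ_iff.mp (Finset.mem_range.mp hk)), mul_assoc]

lemma coeff_one_add_X_pow_mul_eq_zero {m : ℕ} {p : PowerSeries ℚ}
    (hp : ∀ k, m < k → PowerSeries.coeff k p = 0) (j : ℕ) :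
    ∀ k, m + j < k → PowerSeries.coeff k ((1 + PowerSeries.X) ^ j * p) = 0 := by
  induction j with
  | zero => simpa using hp
  | succ j ih =>
    intro k hk
    obtain ⟨k, rfl⟩ : ∃ l, k = l + 1 := ⟨k - 1, by omega⟩
    rw [pow_succ', mul_assoc, add_mul, one_mul, map_add, PowerSeries.coeff_succ_X_mul,
      ih _ (by omega), ih _ (by omega), add_zero]

/-- The factors of the single steps telescope, so only a sum with `N = m` has to be computed by
hand. -/
lemma reciprocalBinomialSum_one_add_X_pow_mul {m : ℕ} {p : PowerSeries ℚ}
    (hp : ∀ k, m < k → PowerSeries.coeff k p = 0) (j : ℕ) :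
    reciprocalBinomialSum (m + j) ((1 + PowerSeries.X) ^ j * p) =
      ((m : ℚ) + j + 1) / (m + 1) * reciprocalBinomialSum m p := by
  have hm : ((m : ℚ) + 1) ≠ 0 := by positivity
  induction j with
  | zero => simp [hm]
  | succ j ih =>
    have hmj : ((m : ℚ) + j + 1) ≠ 0 := by positivity
    rw [← add_assoc, pow_succ', mul_assoc, reciprocalBinomialSum_one_add_X_mul
      (coeff_one_add_X_pow_mul_eq_zero hp j), ih]
    push_cast
    field_simp
    ring

end reciprocalBinomials

/-! ### Sizes of the two conjugacy classes -/

section classes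
variable {n : ℕ}

/-- `cycleType` omits fixed points, which `partition` records as parts 1. -/
lemma parts_eq_iff_cycleType (m : Multiset ℕ) (hm : ∀ a ∈ m, 2 ≤ a) (p : Equiv.Perm (Fin n)) :
    p.partition.parts = m + Multiset.replicate (n - m.sum) 1 ↔ p.cycleType = m := by
  constructor
  · intro h
    rw [← Equiv.Perm.filter_parts_partition_eq_cycleType, h, Multiset.filter_add,
      Multiset.filter_eq_self.mpr hm, Multiset.filter_eq_nil.mpr, add_zero]
    intro a ha
    rw [Multiset.eq_of_mem_replicate ha]
    norm_num
  · intro h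
    rw [Equiv.Perm.parts_partition, ← Equiv.Perm.sum_cycleType, h, Fintype.card_fin]

lemma card_parts_hook3 (hn : 3 ≤ n) :
    (Finset.univ.filter fun p : Equiv.Perm (Fin n) => p.partition.parts = hook3 n).card =
      2 * n.choose 3 := by
  have h1 := Equiv.Perm.card_of_cycleType_mul_eq (Fin n) {3}
  have h2 := Nat.choose_mul_factorial_mul_factorial hn
  rw [if_pos (by simpa using hn)] at h1
  simp only [Fintype.card_fin, Multiset.sum_singleton, Multiset.prod_singleton,
    Multiset.toFinset_singleton, Finset.prod_singleton, Multiset.count_singleton_self,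
    Nat.factorial_one, mul_one] at h1
  rw [← h2, show Nat.factorial 3 = 6 from rfl] at h1
  have h3 := Nat.factorial_pos (n - 3)
  have h4 : (Finset.univ.filter fun p : Equiv.Perm (Fin n) => p.partition.parts = hook3 n).card =
      (Finset.univ.filter fun p : Equiv.Perm (Fin n) => p.cycleType = {3}).card := by
    congr 1
    ext p
    have := parts_eq_iff_cycleType {3} (by simp) p
    rw [Multiset.sum_singleton, Multiset.singleton_add] at this
    simp only [Finset.mem_filter, Finset.mem_univ, true_and]
    exact this
  rw [h4]
  refine Nat.eq_of_mul_eq_mul_right (mul_pos h3 (by norm_num : 0 < 3)) (Eq.trans ?_ (h1.trans ?_))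
  · congr!
  · ring

lemma card_parts_doubleTwo (hn : 4 ≤ n) :
    (Finset.univ.filter fun p : Equiv.Perm (Fin n) => p.partition.parts = doubleTwo n).card =
      3 * n.choose 4 := by
  have h1 := Equiv.Perm.card_of_cycleType_mul_eq (Fin n) {2, 2}
  have h2 := Nat.choose_mul_factorial_mul_factorial hn
  rw [if_pos (by simpa using hn)] at h1
  have h5 : ({2, 2} : Multiset ℕ).toFinset = {2} := by decide
  have h6 : ({2, 2} : Multiset ℕ).sum = 4 := by decide
  have h7 : ({2, 2} : Multiset ℕ).prod = 4 := by decide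
  have h8 : ({2, 2} : Multiset ℕ).count 2 = 2 := by decide
  rw [h5, Finset.prod_singleton, h6, h7, h8, Fintype.card_fin, ← h2,
    show Nat.factorial 4 = 24 from rfl, show Nat.factorial 2 = 2 from rfl] at h1
  have h3 := Nat.factorial_pos (n - 4)
  have h4 : (Finset.univ.filter fun p : Equiv.Perm (Fin n) =>
      p.partition.parts = doubleTwo n).card =
      (Finset.univ.filter fun p : Equiv.Perm (Fin n) => p.cycleType = {2, 2}).card := by
    congr 1
    ext p
    have := parts_eq_iff_cycleType {2, 2} (by simp) p
    rw [h6, Multiset.insert_eq_cons, Multiset.cons_add, Multiset.singleton_add] at this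
    simp only [Finset.mem_filter, Finset.mem_univ, true_and]
    exact this
  rw [h4]
  refine Nat.eq_of_mul_eq_mul_right (mul_pos (mul_pos h3 (by norm_num : 0 < 4))
    (by norm_num : 0 < 2)) (Eq.trans ?_ (h1.trans ?_))
  · congr!
  · ring

end classes

/-! ### The explicit formula yields binomial coefficients -/

section formula

lemma inv_one_add_X_mul_cancel (q : PowerSeries ℚ) :
    (1 + PowerSeries.X : PowerSeries ℚ)⁻¹ * ((1 + PowerSeries.X) * q) = q := by
  rw [← mul_assoc, PowerSeries.inv_mul_cancel _ (by simp), one_mul]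

/-- With `n = j + 3`, one factor `1 + X` cancels and leaves `(1+X)^j (1 - X + X^2)`. The sum for `N
= 2` is `1 - 1/2 + 1 = 3/2`, which scales to `n/2` and cancels against `2 * n.choose 3` and `1/n`.
-/
lemma psiFormula_hook3 {n : ℕ} (hn : 3 ≤ n) : psiFormula n (hook3 n) = n.choose 3 := by
  obtain ⟨j, rfl⟩ := Nat.exists_eq_add_of_le' hn
  have hq : ∀ k, 2 < k →
      PowerSeries.coeff k (1 - PowerSeries.X + PowerSeries.X ^ 2 : PowerSeries ℚ) = 0 := by
    intro k hk
    simp [PowerSeries.coeff_one, PowerSeries.coeff_X, PowerSeries.coeff_X_pow,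
      show k ≠ 0 by omega, show k ≠ 1 by omega, show k ≠ 2 by omega]
  have hS : reciprocalBinomialSum 2 (1 - PowerSeries.X + PowerSeries.X ^ 2) = 3 / 2 := by
    simp [reciprocalBinomialSum, Finset.sum_range_succ, PowerSeries.coeff_one, PowerSeries.coeff_X,
      PowerSeries.coeff_X_pow]
    norm_num
  have key := reciprocalBinomialSum_one_add_X_pow_mul hq j
  have hprod : ((hook3 (j + 3)).map fun i => 1 - (-PowerSeries.X : PowerSeries ℚ) ^ i).prod =
      (1 + PowerSeries.X) *
        ((1 + PowerSeries.X) ^ j * (1 - PowerSeries.X + PowerSeries.X ^ 2)) := by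
    simp only [hook3, Multiset.map_cons, Multiset.map_replicate, Multiset.prod_cons,
      Multiset.prod_replicate, Nat.add_sub_cancel]
    ring
  have hsum : (∑ k ∈ Finset.range (j + 3), ((j + 3 - 1).choose k : ℚ)⁻¹ * PowerSeries.coeff k
      ((1 + PowerSeries.X : PowerSeries ℚ) ^ j * (1 - PowerSeries.X + PowerSeries.X ^ 2))) =
      ((j : ℚ) + 3) / 2 := by
    rw [hS, add_comm 2 j, reciprocalBinomialSum] at key
    rw [show j + 3 - 1 = j + 2 from rfl, key]
    push_cast
    ring
  rw [psiFormula, card_parts_hook3 hn, hprod, inv_one_add_X_mul_cancel, hsum]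
  have : ((j : ℚ) + 3) ≠ 0 := by positivity
  push_cast
  field_simp

/-- With `n = j + 4`, what remains is `(1+X)^(j+1) (1-X)^2`. Its base sum is `1 - 1 + 1 = 1`, which
scales to `n/3`, matching `3 * n.choose 4`. -/
lemma psiFormula_doubleTwo {n : ℕ} (hn : 4 ≤ n) : psiFormula n (doubleTwo n) = n.choose 4 := by
  obtain ⟨j, rfl⟩ := Nat.exists_eq_add_of_le' hn
  have hq : ∀ k, 2 < k →
      PowerSeries.coeff k (1 - 2 * PowerSeries.X + PowerSeries.X ^ 2 : PowerSeries ℚ) = 0 := by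
    intro k hk
    rw [← map_ofNat PowerSeries.C 2]
    simp [PowerSeries.coeff_one, PowerSeries.coeff_X, PowerSeries.coeff_X_pow,
      show k ≠ 0 by omega, show k ≠ 1 by omega, show k ≠ 2 by omega]
  have hS : reciprocalBinomialSum 2 (1 - 2 * PowerSeries.X + PowerSeries.X ^ 2) = 1 := by
    rw [← map_ofNat PowerSeries.C 2]
    simp [reciprocalBinomialSum, Finset.sum_range_succ, PowerSeries.coeff_one, PowerSeries.coeff_X,
      PowerSeries.coeff_X_pow]
  have key := reciprocalBinomialSum_one_add_X_pow_mul hq (j + 1)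
  have hprod : ((doubleTwo (j + 4)).map fun i => 1 - (-PowerSeries.X : PowerSeries ℚ) ^ i).prod =
      (1 + PowerSeries.X) *
        ((1 + PowerSeries.X) ^ (j + 1) * (1 - 2 * PowerSeries.X + PowerSeries.X ^ 2)) := by
    simp only [doubleTwo, Multiset.map_cons, Multiset.map_replicate, Multiset.prod_cons,
      Multiset.prod_replicate, Nat.add_sub_cancel]
    ring
  have hsum : (∑ k ∈ Finset.range (j + 4), ((j + 4 - 1).choose k : ℚ)⁻¹ * PowerSeries.coeff k
      ((1 + PowerSeries.X : PowerSeries ℚ) ^ (j + 1) *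
        (1 - 2 * PowerSeries.X + PowerSeries.X ^ 2))) = ((j : ℚ) + 4) / 3 := by
    rw [hS, add_comm 2 (j + 1), reciprocalBinomialSum] at key
    rw [show j + 4 - 1 = j + 1 + 2 from rfl, key]
    push_cast
    ring
  rw [psiFormula, card_parts_doubleTwo hn, hprod, inv_one_add_X_mul_cancel, hsum]
  have : ((j : ℚ) + 4) ≠ 0 := by positivity
  push_cast
  field_simp

end formula

/-! ### The differential equation for `τ` -/

/-- The polynomial `C'^b g_{••○}`, that is `b! [y^b]` of the derivative of `τ_{•○,0}`. -/
def tauPoly (b : ℕ) : Poly :=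
  gVar [true, true, false] * fVar [true] ^ b +
    (b : ℚ) • (gVar [true, true] * fVar [true, false] * fVar [true] ^ (b - 1))

/-- The solution `τ_{•○,0}`. -/
def tauSeries : SeriesXY := PowerSeries.mk fun b =>
  PowerSeries.C (if b = 0 then 0 else (1 / (b.factorial : ℚ)) • tauPoly (b - 1))

lemma cutPoly_gVar (R : List Bool) : cutPoly (gVar R) =
    ∑ i ∈ Finset.Icc 2 R.length, gVar (R.take i) * fVar (R.take 1 ++ R.drop i) := by
  simp [cutPoly, gVar, MvPolynomial.mkDerivation_X]

lemma cutPoly_fVar (R : List Bool) : cutPoly (fVar R) = 0 := by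
  simp [cutPoly, fVar, MvPolynomial.mkDerivation_X]

/-- The operator sends `g_{••}` to `g_{••} f_•` and `g_{••○}` to `g_{••○} f_• + g_{••} f_{•○}`, and
it kills the `f`-variables; this is a Jordan block, whence the factor `b` in the second term. -/
lemma cutPoly_tauPoly (b : ℕ) : cutPoly (tauPoly b) = tauPoly (b + 1) := by
  have h3 : cutPoly (gVar [true, true, false]) =
      gVar [true, true] * fVar [true, false] + gVar [true, true, false] * fVar [true] := by
    rw [cutPoly_gVar, show Finset.Icc 2 [true, true, false].length = {2, 3} by decide]
    simp
  have h2 : cutPoly (gVar [true, true]) = gVar [true, true] * fVar [true] := by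
    rw [cutPoly_gVar, show Finset.Icc 2 [true, true].length = {2} by decide]
    simp
  simp only [tauPoly, map_add, Derivation.map_smul, Derivation.leibniz, Derivation.leibniz_pow, h2, h3,
    cutPoly_fVar, smul_zero, smul_eq_mul, mul_zero, zero_add, Nat.add_sub_cancel]
  -- For `b = 0` the exponent `b - 1` is truncated, harmlessly, because its term has coefficient 0.
  obtain _ | b := b
  · simp; ring
  · simp only [MvPolynomial.smul_eq_C_mul, Nat.add_sub_cancel]
    push_cast
    simp only [map_add, map_one]
    ring

/-- In no variables, `h_0 = 1` and every higher complete symmetric function is an empty sum. -/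
lemma phi_zero : phi 0 = 1 := by
  ext n : 1
  rw [phi, PowerSeries.coeff_mk, if_pos (Nat.zero_le n), PowerSeries.coeff_one, Nat.sub_zero]
  obtain _ | n := n
  · simp [MvPolynomial.hsymm_zero]
  · have : MvPolynomial.hsymm (Fin 0) ℚ (n + 1) = 0 := by
      rw [MvPolynomial.hsymm]
      exact Finset.sum_eq_zero fun s _ => isEmptyElim s
    simp [this]

lemma coeff_cut_of_coeff_eq_C {T : SeriesXY} {b : ℕ} {P : Poly}
    (h : PowerSeries.coeff b T = PowerSeries.C P) :
    PowerSeries.coeff b (cut T) = PowerSeries.C (cutPoly P) := by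
  ext i : 1
  rw [cut, PowerSeries.coeff_mk, PowerSeries.coeff_mk, h, PowerSeries.coeff_C, PowerSeries.coeff_C]
  split_ifs <;> simp

lemma natCast_add_one_eq_C (b : ℕ) :
    ((b : SeriesX) + 1) = PowerSeries.C (MvPolynomial.C ((b : ℚ) + 1)) := by
  simp

lemma natCast_add_one_ne_zero (b : ℕ) : ((b : SeriesX) + 1) ≠ 0 := by
  rw [natCast_add_one_eq_C, Ne, map_eq_zero_iff _ PowerSeries.C_injective,
    MvPolynomial.C_eq_zero]
  positivity

/-- Coefficientwise the equation reads `(b+1) T_{b+1} = C' T_b`, plus the source `g_{••○}` at `b =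
0`; the factorials absorb `b + 1`. -/
lemma isTau_tauSeries : IsTau [true, false] 0 tauSeries := by
  refine ⟨?_, by simp [tauSeries, ← PowerSeries.coeff_zero_eq_constantCoeff_apply]⟩
  rw [phi_zero, mul_one]
  ext b : 1
  rw [map_sub, PowerSeries.coeff_derivative, coeff_cut_of_coeff_eq_C (PowerSeries.coeff_mk b _),
    constXY, PowerSeries.coeff_C, tauSeries, PowerSeries.coeff_mk]
  rw [natCast_add_one_eq_C, ← map_mul, ← map_sub, if_neg b.succ_ne_zero, Nat.add_sub_cancel]
  obtain _ | b := b
  · simp [tauPoly]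
  · rw [if_neg b.succ_ne_zero, if_neg b.succ_ne_zero, Nat.add_sub_cancel, Derivation.map_smul,
      cutPoly_tauPoly, Nat.factorial_succ (b + 1), mul_comm, ← MvPolynomial.smul_eq_C_mul,
      smul_smul]
    have h1 : (((b + 1 : ℕ) : ℚ) + 1) * (1 / (((b + 1 + 1) * (b + 1).factorial : ℕ) : ℚ)) =
        1 / ((b + 1).factorial : ℚ) := by
      have : ((b + 1).factorial : ℚ) ≠ 0 := by positivity
      push_cast
      field_simp
    rw [h1, sub_self, map_zero]

/-- `C'` acts within each power of `y`, so the equation is a recursion for the coefficients, and `b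
+ 1` can be cancelled. -/
lemma IsTau.unique {R : List Bool} {k : ℕ} {S T : SeriesXY} (hS : IsTau R k S)
    (hT : IsTau R k T) : S = T := by
  ext b : 1
  induction b with
  | zero =>
    rw [PowerSeries.coeff_zero_eq_constantCoeff_apply,
      PowerSeries.coeff_zero_eq_constantCoeff_apply, hS.2, hT.2]
  | succ b ih =>
    have h := congrArg (PowerSeries.coeff b) (hS.1.trans hT.1.symm)
    have hc : PowerSeries.coeff b (cut S) = PowerSeries.coeff b (cut T) := by
      simp only [cut, PowerSeries.coeff_mk, ih]
    rw [map_sub, map_sub, hc, sub_left_inj, PowerSeries.coeff_derivative,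
      PowerSeries.coeff_derivative] at h
    exact mul_right_cancel₀ (natCast_add_one_ne_zero b) h

/-! ### Bi-rooted dipoles without `c`- and `d`-edges -/

namespace BiDipole
variable {n : ℕ} (D : BiDipole n)

lemma root_val : D.root.val = 0 := rfl

lemma sec_ne_root : D.sec ≠ D.root := D.sec_ne

lemma root_lt_sec : D.root < D.sec := by
  have h : D.sec.val ≠ 0 := fun h => D.sec_ne_root (Fin.ext h)
  rw [Fin.lt_def, root_val]
  omega

lemma exists_pow_root (e : Fin n) : ∃ k, (D.rot ^ k) D.root = e := by
  obtain ⟨k, -, hk⟩ :=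
    (D.fullCycle.2 (Set.mem_univ D.root) (Set.mem_univ e)).exists_pow_eq'
  exact ⟨k, hk⟩

/-- Region 4 contains no ordinary edge exactly when the secondary edge is the last one met before
the rotation at the non-root vertex returns to the root edge. Otherwise its successor is an ordinary
edge that can only be reached through it. -/
lemma forall_inRegion3_iff :
    (∀ e, D.IsOrdinary e → D.InRegion3 e) ↔ D.rot D.sec = D.root := by
  constructor
  · intro h
    by_contra hne
    by_cases hs : D.rot D.sec = D.sec
    -- A fixed secondary edge could not be reached from the root edge.
    · obtain ⟨k, hk⟩ := D.exists_pow_root D.sec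
      have hfix : (D.rot ^ k) D.sec = D.sec := by
        clear hk
        induction k with
        | zero => rfl
        | succ k ih => rw [pow_succ, Perm.mul_apply, hs, ih]
      exact D.sec_ne_root ((D.rot ^ k).injective (hfix.trans hk.symm))
    · obtain ⟨k, hk, hj⟩ := h _ ⟨hne, hs⟩
      obtain _ | k := k
      · exact hne hk.symm
      · rw [pow_succ', Perm.mul_apply] at hk
        exact hj k k.le_succ (D.rot.injective hk)
  · intro h e he
    have hex := D.exists_pow_root e
    refine ⟨Nat.find hex, Nat.find_spec hex, fun j hj hs => ?_⟩
    have hjk : j ≠ Nat.find hex := by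
      rintro rfl
      exact he.2 ((Nat.find_spec hex).symm.trans hs)
    -- Passing the secondary edge at time `j` returns to the root edge at time `j + 1`, so dropping
    -- these steps contradicts minimality.
    refine Nat.find_min hex (m := Nat.find hex - (j + 1)) (by omega) ?_
    have h1 : (D.rot ^ (j + 1)) D.root = D.root := by rw [pow_succ', Perm.mul_apply, hs, h]
    have h2 := Nat.find_spec hex
    rw [show Nat.find hex = (Nat.find hex - (j + 1)) + (j + 1) by omega, pow_add,
      Perm.mul_apply, h1] at h2
    exact h2

lemma numC_numD_eq_zero_iff : D.numC = 0 ∧ D.numD = 0 ↔ D.rot D.sec = D.root := by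
  rw [← forall_inRegion3_iff, numC, numD, Finset.card_eq_zero, Finset.card_eq_zero,
    Finset.filter_eq_empty_iff, Finset.filter_eq_empty_iff]
  constructor
  · rintro ⟨h1, h2⟩ e he
    by_contra h3
    by_cases h4 : D.InRegion1 e
    · exact h2 (Finset.mem_univ e) ⟨he, h4, h3⟩
    · exact h1 (Finset.mem_univ e) ⟨he, h4, h3⟩
  · intro h
    exact ⟨fun e _ he => he.2.2 (h e he.1), fun e _ he => he.2.2 (h e he.1)⟩

lemma numA_eq (h : D.rot D.sec = D.root) : D.numA = n - 1 - D.sec := by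
  have h3 := D.forall_inRegion3_iff.mpr h
  rw [← Fin.card_Ioi, numA]
  congr 1
  ext e
  have hr := D.root_lt_sec
  rw [Finset.mem_filter, Finset.mem_Ioi]
  constructor
  · rintro ⟨-, h1, h2, -⟩
    exact lt_of_le_of_ne (not_lt.mp h2) h1.2.symm
  · intro h1
    have ho : D.IsOrdinary e := ⟨(hr.trans h1).ne', h1.ne'⟩
    exact ⟨Finset.mem_univ e, ho, h1.not_gt, h3 e ho⟩

lemma numB_eq (h : D.rot D.sec = D.root) : D.numB = D.sec - 1 := by
  have h3 := D.forall_inRegion3_iff.mpr h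
  have hc := Fin.card_Ioo D.root D.sec
  rw [root_val, Nat.sub_zero] at hc
  rw [← hc, numB]
  congr 1
  ext e
  rw [Finset.mem_filter, Finset.mem_Ioo]
  constructor
  · rintro ⟨-, h1, h2, -⟩
    refine ⟨?_, h2⟩
    have h4 : e.val ≠ 0 := fun h => h1.1 (Fin.ext h)
    rw [Fin.lt_def, root_val]
    omega
  · rintro ⟨h1, h2⟩
    have ho : D.IsOrdinary e := ⟨h1.ne', h2.ne⟩
    exact ⟨Finset.mem_univ e, ho, h2, h3 e ho⟩

/-- The walk leaves the root corner along the root edge and returns along `rot⁻¹` of it; this edge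
is the secondary edge exactly when the walk arrives at the corner before edge `b + 1`. -/
lemma rot_sec_eq_root_iff {b : ℕ} (h : D.sec.val = b + 1) :
    D.rot D.sec = D.root ↔ (D.faceStep D.root).val = b := by
  have hb : b < n := by have := D.sec.isLt; omega
  have h1 : finRotate n ⟨b, hb⟩ = D.sec := finRotate_eq_iff h
  have h2 : (D.faceStep D.root).val = b ↔ D.faceStep D.root = ⟨b, hb⟩ := by
    rw [Fin.ext_iff]
  rw [h2, Dipole.faceStep, Perm.mul_apply, Perm.inv_eq_iff_eq, h1, Perm.inv_eq_iff_eq]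
  exact eq_comm

/-- Toroidal bi-rooted dipoles without `c`- and `d`-edges, in terms of the faces only. -/
def IsToroidal (b : ℕ) : Prop :=
  D.sec.val = b + 1 ∧ (D.faceStep D.root).val = b ∧ D.faces.card + 2 = n

end BiDipole

/-- The condition on `numA` follows from the others, as the total number of edges is `i + b + 1`. -/
lemma isToroidal_iff {i b : ℕ} (D : BiDipole (i + b + 1)) :
    (D.numC = 0 ∧ D.numD = 0 ∧ D.numA + 1 = i ∧ D.numB = b ∧ D.twoGenus = ((2 * 1 : ℕ) : ℤ)) ↔
      D.IsToroidal b := by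
  have hs := D.sec.isLt
  have hr := D.root_lt_sec
  rw [Fin.lt_def, D.root_val] at hr
  rw [← and_assoc, D.numC_numD_eq_zero_iff, BiDipole.IsToroidal, Dipole.twoGenus]
  constructor
  · rintro ⟨h1, h2, h3, h4⟩
    rw [D.numB_eq h1] at h3
    have h5 : D.sec.val = b + 1 := by omega
    refine ⟨h5, (D.rot_sec_eq_root_iff h5).mp h1, ?_⟩
    push_cast at h4
    omega
  · rintro ⟨h5, h2, h4⟩
    have h1 := (D.rot_sec_eq_root_iff h5).mpr h2
    refine ⟨h1, ?_, ?_, ?_⟩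
    · rw [D.numA_eq h1]
      omega
    · rw [D.numB_eq h1]
      omega
    · push_cast
      omega

lemma coeff_seriesBGenus_one (b i : ℕ) :
    PowerSeries.coeff i (PowerSeries.coeff b (seriesBGenus 1)) =
      (1 / ((i.factorial : ℚ) * (b.factorial : ℚ))) •
        ∑ D : BiDipole (i + b + 1) with D.IsToroidal b, encoding D := by
  rw [seriesBGenus, seriesB, PowerSeries.coeff_mk, PowerSeries.coeff_mk, PowerSeries.coeff_mk,
    Finset.smul_sum]
  exact Finset.sum_congr (Finset.filter_congr fun D _ => isToroidal_iff D) fun _ _ => rfl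

/-! ### The monomial of each toroidal bi-rooted dipole -/

section encoding
variable {n : ℕ} (D : BiDipole n)

/-- The indeterminate that encodes a face. -/
def BiDipole.faceVar (F : Cycle (Fin n)) : Poly := MvPolynomial.X (Indet.f (F.map D.mark))

lemma BiDipole.faceVar_coe (l : List (Fin n)) :
    D.faceVar (l : Cycle (Fin n)) = fVar (l.map D.mark) := rfl

lemma fVar_ne_zero (S : List Bool) : fVar S ≠ 0 := MvPolynomial.X_ne_zero _

/-- Restoring the root face's own variable turns the product over non-root faces into one over all
faces. `Poly` is a domain, so that variable can be cancelled afterwards. -/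
lemma encoding_mul_faceVar :
    encoding D * D.faceVar D.rootFace = gVar D.rootString * ∏ F ∈ D.faces, D.faceVar F := by
  have h : D.rootFace ∈ D.faces := D.mem_faces.mpr ⟨D.root, rfl⟩
  rw [← Finset.prod_erase_mul _ _ h, ← mul_assoc, encoding, BiDipole.nonRootStrings,
    Multiset.map_map]
  rfl

lemma prod_faceVar_singleton :
    ∏ x : Fin n, D.faceVar ([x] : Cycle (Fin n)) =
      fVar [true] ^ D.sec.val * fVar [false] ^ (n - D.sec.val) := by
  have h : ∀ x : Fin n, D.faceVar ([x] : Cycle (Fin n)) =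
      if x < D.sec then fVar [true] else fVar [false] := by
    intro x
    rw [D.faceVar_coe]
    by_cases hx : x < D.sec <;> simp [BiDipole.mark, hx]
  rw [Finset.prod_congr rfl fun x _ => h x, Finset.prod_ite, Finset.prod_const, Finset.prod_const]
  have h1 : (Finset.univ.filter fun x : Fin n => x < D.sec) = Finset.Iio D.sec := by
    ext; simp
  have h2 : (Finset.univ.filter fun x : Fin n => ¬ x < D.sec) = Finset.Ici D.sec := by
    ext; simp
  rw [h1, h2, Fin.card_Iio, Fin.card_Ici]

variable {D}

lemma mark_of_lt {x : Fin n} (h : x < D.sec) : D.mark x = true := by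
  simp [BiDipole.mark, h]

lemma mark_of_le {x : Fin n} (h : D.sec ≤ x) : D.mark x = false := by
  simp [BiDipole.mark, h]

/-- There are `q + 1` black corners and `n - q - 1` white ones; the root face takes two black and
one white, and the rest are digons. -/
lemma encoding_threeCycle_root {q r : Fin n} (h0 : D.root < q) (hqr : q < r)
    (h : D.faceStep = threeCycle D.root q r) (hs : D.sec.val = q.val + 1) :
    encoding D = gVar [true, true, false] *
      (fVar [true] ^ (q.val - 1) * fVar [false] ^ (n - q.val - 2)) := by
  have e1 : D.faceStep D.root = q := by
    rw [h, threeCycle_apply h0.ne hqr.ne (h0.trans hqr).ne, if_pos rfl]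
  have e2 : D.faceStep q = r := by
    rw [h, threeCycle_apply h0.ne hqr.ne (h0.trans hqr).ne, if_neg h0.ne', if_pos rfl]
  have e3 : D.faceStep r = D.root := by
    rw [h, threeCycle_apply h0.ne hqr.ne (h0.trans hqr).ne, if_neg (h0.trans hqr).ne',
      if_neg hqr.ne', if_pos rfl]
  have m1 : D.mark D.root = true := mark_of_lt D.root_lt_sec
  have m2 : D.mark q = true := mark_of_lt (by omega)
  have m3 : D.mark r = false := mark_of_le (by omega)
  have hroot : D.rootString = [true, true, false] := by
    rw [BiDipole.rootString, D.minimalPeriod_of_three h0.ne e1 e2 e3]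
    simp [List.range_succ, e1, e2, m1, m2, m3]
  have hface : D.rootFace = ([D.root, q, r] : Cycle (Fin n)) :=
    (D.faces_threeCycle h0 hqr h).2.2
  have key := encoding_mul_faceVar D
  have hprod := D.prod_faces_threeCycle h0 hqr h D.faceVar
  rw [prod_faceVar_singleton, hs] at hprod
  rw [hface, hroot] at key
  simp only [BiDipole.faceVar_coe, List.map_cons, List.map_nil, m1, m2, m3] at key hprod
  have hq : q.val + 1 = q.val - 1 + 2 := by rw [Fin.lt_def, D.root_val] at h0; omega
  rw [hq, show n - (q.val - 1 + 2) = n - q.val - 2 + 1 by omega] at hprod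
  refine mul_right_cancel₀ (mul_ne_zero (fVar_ne_zero [true, true, false])
    (mul_ne_zero (mul_ne_zero (fVar_ne_zero [true]) (fVar_ne_zero [true]))
      (fVar_ne_zero [false]))) ?_
  rw [← mul_assoc, key, mul_assoc, hprod]
  ring

/-- Of the `c + 1` black corners, the root face takes two and the other face of degree 4 takes one,
together with the white corner `d`. -/
lemma encoding_doubleSwap_root {b c d : Fin n} (h0 : D.root < b) (hbc : b < c) (hcd : c < d)
    (h : D.faceStep = doubleSwap D.root b c d) (hs : D.sec.val = c.val + 1) :
    encoding D = gVar [true, true] *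
      (fVar [true, false] * fVar [true] ^ (c.val - 2) * fVar [false] ^ (n - c.val - 2)) := by
  have e1 : D.faceStep D.root = c := by
    rw [h, doubleSwap_apply h0 hbc hcd, if_pos rfl]
  have e2 : D.faceStep c = D.root := by
    rw [h, doubleSwap_apply h0 hbc hcd, if_neg (h0.trans hbc).ne', if_neg hbc.ne', if_pos rfl]
  have m1 : D.mark D.root = true := mark_of_lt D.root_lt_sec
  have m2 : D.mark b = true := mark_of_lt (by omega)
  have m3 : D.mark c = true := mark_of_lt (by omega)
  have m4 : D.mark d = false := mark_of_le (by omega)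
  have hroot : D.rootString = [true, true] := by
    rw [BiDipole.rootString, D.minimalPeriod_of_swap (h0.trans hbc).ne e1 e2]
    simp [List.range_succ, e1, m1, m3]
  have hface : D.rootFace = ([D.root, c] : Cycle (Fin n)) :=
    (D.faces_doubleSwap h0 hbc hcd h).2.2.2
  have key := encoding_mul_faceVar D
  have hprod := D.prod_faces_doubleSwap h0 hbc hcd h D.faceVar
  rw [prod_faceVar_singleton, hs] at hprod
  rw [hface, hroot] at key
  simp only [BiDipole.faceVar_coe, List.map_cons, List.map_nil, m1, m2, m3, m4] at key hprod
  have hq : c.val + 1 = c.val - 2 + 3 := by rw [Fin.lt_def, D.root_val] at h0; omega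
  rw [hq, show n - (c.val - 2 + 3) = n - c.val - 2 + 1 by omega] at hprod
  refine mul_right_cancel₀ (mul_ne_zero (fVar_ne_zero [true, true])
    (mul_ne_zero (mul_ne_zero (mul_ne_zero (fVar_ne_zero [true]) (fVar_ne_zero [true]))
      (fVar_ne_zero [true])) (fVar_ne_zero [false]))) ?_
  rw [← mul_assoc, key, mul_assoc, hprod]
  ring

/-- The root corner is the only black corner and forms a digon by itself, so every other face is
white. -/
lemma encoding_threeCycle_of_ne_root {p q r : Fin n} (h0 : D.root < p) (hpq : p < q)
    (hqr : q < r) (h : D.faceStep = threeCycle p q r) (hs : D.sec.val = 1) :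
    encoding D = gVar [true] * (fVar [false, false, false] * fVar [false] ^ (n - 4)) := by
  have e1 : D.faceStep D.root = D.root := by
    rw [h, threeCycle_apply hpq.ne hqr.ne (hpq.trans hqr).ne, if_neg h0.ne,
      if_neg (h0.trans hpq).ne, if_neg (h0.trans (hpq.trans hqr)).ne]
  have m0 : D.mark D.root = true := mark_of_lt D.root_lt_sec
  have hp : 1 ≤ p.val := by rw [Fin.lt_def, D.root_val] at h0; omega
  have m1 : D.mark p = false := mark_of_le (by omega)
  have m2 : D.mark q = false := mark_of_le (by omega)
  have m3 : D.mark r = false := mark_of_le (by omega)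
  have hroot : D.rootString = [true] := by
    rw [BiDipole.rootString, D.minimalPeriod_of_fixed e1]
    simp [List.range_succ, m0]
  have hface : D.rootFace = ([D.root] : Cycle (Fin n)) := D.faceOf_of_fixed e1
  have key := encoding_mul_faceVar D
  have hprod := D.prod_faces_threeCycle hpq hqr h D.faceVar
  rw [prod_faceVar_singleton, hs] at hprod
  rw [hface, hroot] at key
  simp only [BiDipole.faceVar_coe, List.map_cons, List.map_nil, m0, m1, m2, m3] at key hprod
  rw [show n - 1 = n - 4 + 3 by omega] at hprod
  refine mul_right_cancel₀ (mul_ne_zero (fVar_ne_zero [true])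
    (mul_ne_zero (mul_ne_zero (fVar_ne_zero [false]) (fVar_ne_zero [false]))
      (fVar_ne_zero [false]))) ?_
  rw [← mul_assoc, key, mul_assoc, hprod]
  ring

lemma encoding_doubleSwap_of_ne_root {a b c d : Fin n} (h0 : D.root < a) (hab : a < b)
    (hbc : b < c) (hcd : c < d) (h : D.faceStep = doubleSwap a b c d) (hs : D.sec.val = 1) :
    encoding D = gVar [true] * (fVar [false, false] ^ 2 * fVar [false] ^ (n - 5)) := by
  have e1 : D.faceStep D.root = D.root := by
    rw [h, doubleSwap_apply hab hbc hcd, if_neg h0.ne, if_neg (h0.trans hab).ne,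
      if_neg (h0.trans (hab.trans hbc)).ne, if_neg (h0.trans (hab.trans (hbc.trans hcd))).ne]
  have m0 : D.mark D.root = true := mark_of_lt D.root_lt_sec
  have hp : 1 ≤ a.val := by rw [Fin.lt_def, D.root_val] at h0; omega
  have m1 : D.mark a = false := mark_of_le (by omega)
  have m2 : D.mark b = false := mark_of_le (by omega)
  have m3 : D.mark c = false := mark_of_le (by omega)
  have m4 : D.mark d = false := mark_of_le (by omega)
  have hroot : D.rootString = [true] := by
    rw [BiDipole.rootString, D.minimalPeriod_of_fixed e1]
    simp [List.range_succ, m0]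
  have hface : D.rootFace = ([D.root] : Cycle (Fin n)) := D.faceOf_of_fixed e1
  have key := encoding_mul_faceVar D
  have hprod := D.prod_faces_doubleSwap hab hbc hcd h D.faceVar
  rw [prod_faceVar_singleton, hs] at hprod
  rw [hface, hroot] at key
  simp only [BiDipole.faceVar_coe, List.map_cons, List.map_nil, m0, m1, m2, m3, m4] at key hprod
  rw [show n - 1 = n - 5 + 4 by omega] at hprod
  refine mul_right_cancel₀ (mul_ne_zero (fVar_ne_zero [true])
    (mul_ne_zero (mul_ne_zero (mul_ne_zero (fVar_ne_zero [false]) (fVar_ne_zero [false]))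
      (fVar_ne_zero [false])) (fVar_ne_zero [false]))) ?_
  rw [← mul_assoc, key, mul_assoc, hprod]
  ring

end encoding

/-! ### Summing the encodings for given `b` -/

section sums
variable {n : ℕ}

lemma card_biDipole_sec_eq {s : Fin n} (hs : s.val ≠ 0) (P : Dipole n → Prop)
    [DecidablePred P] :
    (Finset.univ.filter fun D : BiDipole n => D.sec = s ∧ P D.toDipole).card =
      (Finset.univ.filter P).card := by
  refine Finset.card_bij (fun D _ => D.toDipole) ?_ ?_ ?_
  · intro D hD
    exact Finset.mem_filter.mpr ⟨Finset.mem_univ _, (Finset.mem_filter.mp hD).2.2⟩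
  · rintro ⟨D, t, ht⟩ hD ⟨D', t', ht'⟩ hD' h
    obtain rfl : t = s := (Finset.mem_filter.mp hD).2.1
    obtain rfl : t' = t := (Finset.mem_filter.mp hD').2.1
    cases h
    rfl
  · intro D hD
    refine ⟨⟨D, s, fun h => hs (by rw [h])⟩, Finset.mem_filter.mpr ⟨Finset.mem_univ _, rfl, ?_⟩, rfl⟩
    exact (Finset.mem_filter.mp hD).2

lemma Dipole.not_threeCycle_and_doubleSwap (D : Dipole n) {p q r a b c d : Fin n} (hpq : p < q)
    (hqr : q < r) (h : D.faceStep = threeCycle p q r) (hab : a < b) (hbc : b < c) (hcd : c < d)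
    (h' : D.faceStep = doubleSwap a b c d) : False := by
  have h1 := (D.halfFaceDegrees_threeCycle hpq hqr h).symm.trans
    (D.halfFaceDegrees_doubleSwap hab hbc hcd h')
  have : 3 ∈ doubleTwo n := h1 ▸ Multiset.mem_cons_self 3 _
  simp [doubleTwo, Multiset.mem_replicate] at this

/-- Splitting a sum over toroidal bi-rooted dipoles by the two types of face degrees. -/
lemma sum_isToroidal_eq {b : ℕ} {s : Fin n} (hs : s.val = b + 1)
    (Q : Fin n → Fin n → Fin n → Prop) (Q' : Fin n → Fin n → Fin n → Fin n → Prop)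
    (hQ : ∀ (D : BiDipole n) (p q r : Fin n), p < q → q < r → D.faceStep = threeCycle p q r →
      ((D.faceStep D.root).val = b ↔ Q p q r))
    (hQ' : ∀ (D : BiDipole n) (a b' c d : Fin n), a < b' → b' < c → c < d →
      D.faceStep = doubleSwap a b' c d → ((D.faceStep D.root).val = b ↔ Q' a b' c d))
    {E E' : Poly}
    (hE : ∀ (D : BiDipole n) (p q r : Fin n), D.sec.val = b + 1 → p < q → q < r →
      D.faceStep = threeCycle p q r → Q p q r → encoding D = E)
    (hE' : ∀ (D : BiDipole n) (a b' c d : Fin n), D.sec.val = b + 1 → a < b' → b' < c → c < d →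
      D.faceStep = doubleSwap a b' c d → Q' a b' c d → encoding D = E') :
    ∑ D : BiDipole n with D.IsToroidal b, encoding D =
      (increasingTriples n Q).card • E + (increasingQuadruples n Q').card • E' := by
  have hs0 : s.val ≠ 0 := by omega
  rw [← card_dipole_threeCycle, ← card_dipole_doubleSwap, ← card_biDipole_sec_eq hs0,
    ← card_biDipole_sec_eq hs0, ← Finset.sum_const, ← Finset.sum_const]
  have hset : (Finset.univ.filter fun D : BiDipole n => D.IsToroidal b) =
      (Finset.univ.filter fun D : BiDipole n => D.sec = s ∧ ∃ p q r, p < q ∧ q < r ∧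
        D.faceStep = threeCycle p q r ∧ Q p q r) ∪
      (Finset.univ.filter fun D : BiDipole n => D.sec = s ∧ ∃ a b c d, a < b ∧ b < c ∧ c < d ∧
        D.faceStep = doubleSwap a b c d ∧ Q' a b c d) := by
    ext D
    rw [Finset.mem_union, Finset.mem_filter, Finset.mem_filter, Finset.mem_filter,
      BiDipole.IsToroidal, Dipole.card_faces_add_two_iff, Fin.ext_iff, hs]
    constructor
    · rintro ⟨-, h1, h2, ⟨p, q, r, h3, h4, h5⟩ | ⟨a, b', c, d, h3, h4, h5, h6⟩⟩
      · exact Or.inl ⟨Finset.mem_univ _, h1, p, q, r, h3, h4, h5, (hQ D p q r h3 h4 h5).mp h2⟩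
      · exact Or.inr ⟨Finset.mem_univ _, h1, a, b', c, d, h3, h4, h5, h6,
          (hQ' D a b' c d h3 h4 h5 h6).mp h2⟩
    · rintro (⟨-, h1, p, q, r, h3, h4, h5, h6⟩ | ⟨-, h1, a, b', c, d, h3, h4, h5, h6, h7⟩)
      · exact ⟨Finset.mem_univ _, h1, (hQ D p q r h3 h4 h5).mpr h6, Or.inl ⟨p, q, r, h3, h4, h5⟩⟩
      · exact ⟨Finset.mem_univ _, h1, (hQ' D a b' c d h3 h4 h5 h6).mpr h7,
          Or.inr ⟨a, b', c, d, h3, h4, h5, h6⟩⟩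
  have hdisj : Disjoint
      (Finset.univ.filter fun D : BiDipole n => D.sec = s ∧ ∃ p q r, p < q ∧ q < r ∧
        D.faceStep = threeCycle p q r ∧ Q p q r)
      (Finset.univ.filter fun D : BiDipole n => D.sec = s ∧ ∃ a b c d, a < b ∧ b < c ∧ c < d ∧
        D.faceStep = doubleSwap a b c d ∧ Q' a b c d) := by
    refine Finset.disjoint_left.mpr fun D h h' => ?_
    obtain ⟨-, -, p, q, r, h1, h2, h3, -⟩ := Finset.mem_filter.mp h
    obtain ⟨-, -, a, b, c, d, h4, h5, h6, h7, -⟩ := Finset.mem_filter.mp h'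
    exact D.not_threeCycle_and_doubleSwap h1 h2 h3 h4 h5 h6 h7
  rw [hset, Finset.sum_union hdisj]
  congr 1
  · refine Finset.sum_congr rfl fun D hD => ?_
    obtain ⟨-, h1, p, q, r, h3, h4, h5, h6⟩ := Finset.mem_filter.mp hD
    exact hE D p q r (by rw [h1, hs]) h3 h4 h5 h6
  · refine Finset.sum_congr rfl fun D hD => ?_
    obtain ⟨-, h1, a, b', c, d, h3, h4, h5, h6, h7⟩ := Finset.mem_filter.mp hD
    exact hE' D a b' c d (by rw [h1, hs]) h3 h4 h5 h6 h7

/-- As `b > 0`, the root corner `0` is moved, and being least it is the first entry of the normal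
form. Its image is the second entry of a triple but the third of a quadruple. -/
lemma sum_isToroidal_of_pos {b : ℕ} (hb : 0 < b) (hn : b + 1 < n) :
    ∑ D : BiDipole n with D.IsToroidal b, encoding D =
      (n - 1 - b) • (gVar [true, true, false] *
        (fVar [true] ^ (b - 1) * fVar [false] ^ (n - b - 2))) +
      ((b - 1) * (n - 1 - b)) • (gVar [true, true] *
        (fVar [true, false] * fVar [true] ^ (b - 2) * fVar [false] ^ (n - b - 2))) := by
  have hn0 : 0 < n := by omega
  have hbn : b < n := by omega
  rw [show (b - 1) * (n - 1 - b) = _ from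
      (card_increasingQuadruples_odd (⟨0, hn0⟩ : Fin n) ⟨b, hbn⟩).symm,
    ← card_increasingTriples_first (⟨0, hn0⟩ : Fin n) ⟨b, hbn⟩ (Fin.mk_lt_mk.mpr hb)]
  refine sum_isToroidal_eq (s := ⟨b + 1, hn⟩) rfl _ _ ?_ ?_ ?_ ?_
  · intro D p q r hpq hqr h
    have hr : D.root.val = 0 := rfl
    rw [h, threeCycle_apply hpq.ne hqr.ne (hpq.trans hqr).ne]
    simp only [Fin.ext_iff, apply_ite Fin.val]
    rw [Fin.lt_def] at hpq hqr
    split_ifs <;> omega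
  · intro D a b' c d hab hbc hcd h
    have hr : D.root.val = 0 := rfl
    rw [h, doubleSwap_apply hab hbc hcd]
    simp only [Fin.ext_iff, apply_ite Fin.val]
    rw [Fin.lt_def] at hab hbc hcd
    split_ifs <;> omega
  · rintro D p q r hs hpq hqr h ⟨rfl, rfl⟩
    have key := encoding_threeCycle_root (D := D) hpq hqr h hs
    exact key
  · rintro D a b' c d hs hab hbc hcd h ⟨rfl, rfl⟩
    have key := encoding_doubleSwap_root (D := D) hab hbc hcd h hs
    exact key

/-- Here the root corner is fixed, so the normal form is any increasing triple or quadruple avoiding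
`0`. -/
lemma sum_isToroidal_zero (hn : 1 < n) :
    ∑ D : BiDipole n with D.IsToroidal 0, encoding D =
      (n - 1).choose 3 • (gVar [true] * (fVar [false, false, false] * fVar [false] ^ (n - 4))) +
      (n - 1).choose 4 • (gVar [true] * (fVar [false, false] ^ 2 * fVar [false] ^ (n - 5))) := by
  have hn0 : 0 < n := by omega
  have hcard : (Finset.univ.erase (⟨0, hn0⟩ : Fin n)).card = n - 1 := by
    rw [Finset.card_erase_of_mem (Finset.mem_univ _), Finset.card_univ, Fintype.card_fin]
  rw [← hcard, ← card_increasingTriples_mem, ← card_increasingQuadruples_mem]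
  refine sum_isToroidal_eq (s := ⟨1, hn⟩) rfl _ _ ?_ ?_ ?_ ?_
  · intro D p q r hpq hqr h
    have hr : D.root.val = 0 := rfl
    rw [h, threeCycle_apply hpq.ne hqr.ne (hpq.trans hqr).ne]
    simp only [Fin.ext_iff, apply_ite Fin.val, Finset.mem_erase, Finset.mem_univ, and_true, Ne]
    rw [Fin.lt_def] at hpq hqr
    split_ifs <;> omega
  · intro D a b' c d hab hbc hcd h
    have hr : D.root.val = 0 := rfl
    rw [h, doubleSwap_apply hab hbc hcd]
    simp only [Fin.ext_iff, apply_ite Fin.val, Finset.mem_erase, Finset.mem_univ, and_true, Ne]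
    rw [Fin.lt_def] at hab hbc hcd
    split_ifs <;> omega
  · rintro D p q r hs hpq hqr h ⟨h0, -⟩
    exact encoding_threeCycle_of_ne_root
      (lt_of_le_of_ne (Nat.zero_le p.val) (Finset.ne_of_mem_erase h0).symm) hpq hqr h hs
  · rintro D a b' c d hs hab hbc hcd h ⟨h0, -⟩
    exact encoding_doubleSwap_of_ne_root
      (lt_of_le_of_ne (Nat.zero_le a.val) (Finset.ne_of_mem_erase h0).symm) hab hbc hcd h hs

end sums

/-! ### Comparing coefficients -/

section series

lemma coeff_succ_xExp (j : ℕ) :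
    PowerSeries.coeff (j + 1) xExp = (1 / (j.factorial : ℚ)) • fVar [false] ^ j := by
  rw [xExp, PowerSeries.coeff_succ_X_mul, PowerSeries.coeff_rescale, PowerSeries.coeff_exp,
    MvPolynomial.algebraMap_eq, mul_comm, MvPolynomial.smul_eq_C_mul]

lemma coeff_zero_xExp : PowerSeries.coeff 0 xExp = 0 := by
  simp [xExp]

lemma coeff_hookSeries (i : ℕ) : PowerSeries.coeff i hookSeries =
    ((i.choose 3 : ℚ) / (i.factorial : ℚ)) •
      (fVar [false, false, false] * fVar [false] ^ (i - 3)) := by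
  rw [hookSeries, PowerSeries.coeff_mk]
  split_ifs with h
  · rw [psi_hook3 h]
  · rw [Nat.choose_eq_zero_of_lt (not_le.mp h), Nat.cast_zero, zero_div, zero_smul]

lemma coeff_doubleTwoSeries (i : ℕ) : PowerSeries.coeff i doubleTwoSeries =
    ((i.choose 4 : ℚ) / (i.factorial : ℚ)) •
      (fVar [false, false] ^ 2 * fVar [false] ^ (i - 4)) := by
  rw [doubleTwoSeries, PowerSeries.coeff_mk]
  split_ifs with h
  · rw [psi_doubleTwo h]
  · rw [Nat.choose_eq_zero_of_lt (not_le.mp h), Nat.cast_zero, zero_div, zero_smul]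

lemma sum_isToroidal_of_le {n b : ℕ} (h : n ≤ b + 1) :
    ∑ D : BiDipole n with D.IsToroidal b, encoding D = 0 := by
  rw [Finset.sum_eq_zero]
  intro D hD
  have h1 := (Finset.mem_filter.mp hD).2.1
  have := D.sec.isLt
  omega

/-- The generating series for toroidal bi-rooted dipoles without `c`- and `d`-edges. -/
theorem seriesBGenus_one : seriesBGenus 1 =
    tauSeries * PowerSeries.C xExp +
      constXY (gVar [true]) * PowerSeries.C (hookSeries + doubleTwoSeries) := by
  ext b : 1
  ext i : 1
  rw [coeff_seriesBGenus_one, map_add, PowerSeries.coeff_mul_C, constXY, PowerSeries.coeff_mul_C,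
    tauSeries, PowerSeries.coeff_mk, PowerSeries.coeff_C, map_add]
  obtain _ | b := b
  · rw [if_pos rfl, if_pos rfl, map_zero, zero_mul, map_zero, zero_add, PowerSeries.coeff_C_mul,
      map_add, coeff_hookSeries, coeff_doubleTwoSeries]
    obtain _ | j := i
    · rw [sum_isToroidal_of_le (by omega)]
      simp
    -- With `b = 0` there are `i + 1` edges, so the choices avoiding the root corner number
    -- `i.choose 3` and `i.choose 4`, the values of `psi` on `i` edges.
    · rw [sum_isToroidal_zero (by omega)]
      simp only [add_zero, Nat.add_sub_cancel, show j + 1 + 1 - 4 = j + 1 - 3 by omega,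
        show j + 1 + 1 - 5 = j + 1 - 4 by omega, ← Nat.cast_smul_eq_nsmul ℚ, smul_add, smul_smul,
        mul_add, mul_smul_comm, Nat.factorial_zero, Nat.cast_one, mul_one, div_eq_inv_mul]
  · rw [if_neg b.succ_ne_zero, if_neg b.succ_ne_zero, zero_mul, map_zero, add_zero,
      PowerSeries.coeff_C_mul]
    obtain _ | j := i
    · rw [sum_isToroidal_of_le (by omega), coeff_zero_xExp, smul_zero, mul_zero]
    · rw [sum_isToroidal_of_pos (by omega) (by omega), coeff_succ_xExp, tauPoly]
      have h1 : j + 1 + (b + 1) + 1 - 1 - (b + 1) = j + 1 := by omega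
      have h2 : j + 1 + (b + 1) + 1 - (b + 1) - 2 = j := by omega
      have h3 : b + 1 - 2 = b - 1 := by omega
      -- The `j + 1` positions of the one white corner in a non-digon face turn `1/(j+1)!` into the
      -- `1/j!` of the exponential.
      have h4 : (1 / (((j + 1).factorial : ℚ) * ((b + 1).factorial : ℚ))) * ((j : ℚ) + 1) =
          (1 / ((b + 1).factorial : ℚ)) * (1 / (j.factorial : ℚ)) := by
        rw [Nat.factorial_succ j]
        have : (j.factorial : ℚ) ≠ 0 := by positivity
        have : ((b + 1).factorial : ℚ) ≠ 0 := by positivity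
        push_cast
        field_simp
      rw [h1, h2, h3, Nat.add_sub_cancel, ← Nat.cast_smul_eq_nsmul ℚ, ← Nat.cast_smul_eq_nsmul ℚ,
        smul_mul_smul_comm, ← h4, mul_smul]
      congr 1
      simp only [MvPolynomial.smul_eq_C_mul]
      push_cast
      simp only [map_add, map_mul, map_one]
      ring

end series

end DipoleSeries

end

theorem mainTheorem6 :
    (∃! T : DipoleSeries.SeriesXY, DipoleSeries.IsTau [true, false] 0 T) ∧
    (∀ T : DipoleSeries.SeriesXY, DipoleSeries.IsTau [true, false] 0 T →
      DipoleSeries.seriesBGenus 1 =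
        T * PowerSeries.C DipoleSeries.xExp +
          DipoleSeries.constXY (DipoleSeries.gVar [true]) *
            PowerSeries.C (DipoleSeries.hookSeries + DipoleSeries.doubleTwoSeries)) ∧
    (∀ n : ℕ, 3 ≤ n →
      (DipoleSeries.psi n (DipoleSeries.hook3 n) : ℚ) =
        DipoleSeries.psiFormula n (DipoleSeries.hook3 n)) ∧
    (∀ n : ℕ, 4 ≤ n →
      (DipoleSeries.psi n (DipoleSeries.doubleTwo n) : ℚ) =
        DipoleSeries.psiFormula n (DipoleSeries.doubleTwo n)) := by
  refine ⟨⟨DipoleSeries.tauSeries, DipoleSeries.isTau_tauSeries,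
    fun T hT => hT.unique DipoleSeries.isTau_tauSeries⟩, fun T hT => ?_, fun n hn => ?_,
    fun n hn => ?_⟩
  · rw [hT.unique DipoleSeries.isTau_tauSeries]
    exact DipoleSeries.seriesBGenus_one
  · rw [DipoleSeries.psi_hook3 hn, DipoleSeries.psiFormula_hook3 hn]
  · rw [DipoleSeries.psi_doubleTwo hn, DipoleSeries.psiFormula_doubleTwo hn]
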